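/- Let $G=(V,E)$ be a connected simple graph, embedded without self-intersections in a topological surface $\mathcal S$ homeomorphic to $\mathbb R^2$: the vertices are distinct points of $\mathcal S$, the edges are simple curves joining their end vertices, and two different edges intersect only in the vertices they have in common. Assume that the embedding is locally compact, that is, every compact subset of $\mathcal S$ intersects only finitely many edges (in particular $G$ is locally finite). Let $F$ be the set of faces, i.e. of the closures of the connected components of $\mathcal S\setminus\bigcup E$, and assume that $G=(V,E,F)$ is a (planar) tessellation: (T1) every edge is included in exactly two faces; (T2) any two different faces are either disjoint or intersect in exactly one vertex or in exactly one edge; (T3) every face is homeomorphic to a closed disc. For $v\in V$ let $d_v$ be the degree of $v$, for $f\in F$ let $\deg(f)$ be the number of edges included in $f$, and let $$\Phi(v)=1-\frac{d_v}{2}+\sum_{f\in F,\ v\in f}\frac1{\deg(f)}$$ be the vertex curvature. Define the asymptotic average curvature $$\overline\Phi=\lim_{n\to\infty}\ \sup_{W\subseteq V\text{ finite},\ \#W\ge n}\ \frac1{\#W}\sum_{v\in W}\Phi(v)\in[-\infty,\infty),$$ where the limit exists because the sequence is decreasing. Let $-\Delta$ be the combinatorial Laplacian $$(-\Delta\varphi)(v)=\sum_{w\sim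 v}(\varphi(v)-\varphi(w))$$ on the complex Hilbert space $\ell^2(V)$ (with the counting measure on $V$), with domain $D(\Delta)=\{\varphi\in\ell^2(V)\mid\Delta\varphi\in\ell^2(V)\}$, and let $\sigma(-\Delta)$ be the set of all $z\in\mathbb C$ such that $-\Delta-z:D(\Delta)\to\ell^2(V)$ has no bounded inverse defined on all of $\ell^2(V)$. **Theorem.** If $\overline\Phi<0$, then $-\Delta$ has a spectral gap: the spectrum $\sigma(-\Delta)$ consists of real numbers, it has a minimum $\lambda_0=\min\sigma(-\Delta)$, and $\lambda_0>0$. -/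

import Mathlib

open Set Filter Topology
open scoped ENNReal

noncomputable section

namespace PlanarTess

/-! ### Embedded graphs and tessellations -/

/-- A locally compact embedding, without self-intersections, of the simple graph `G` into the
topological space `S`: vertices are points of `S`, every edge is a simple curve joining its end
vertices, distinct edges meet only in common end vertices, and every compact subset of `S` meets
only finitely many edges. -/
structure SurfaceEmbedding {V : Type*} (G : SimpleGraph V) (S : Type*) [TopologicalSpace S] where
  pos : V → S
  pos_injective : Function.Injective pos
  curve : G.edgeSet → unitInterval → S
  curve_continuous : ∀ e, Continuous (curve e)
  curve_injective : ∀ e, Function.Injective (curve e)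
  curve_ends : ∀ e, s(curve e 0, curve e 1) = Sym2.map pos (e : Sym2 V)
  vertex_on_curve : ∀ v e t, curve e t = pos v → v ∈ (e : Sym2 V)
  curves_meet : ∀ e e' t t', e ≠ e' → curve e t = curve e' t' →
    ∃ v, v ∈ (e : Sym2 V) ∧ v ∈ (e' : Sym2 V) ∧ curve e t = pos v
  locally_compact : ∀ K : Set S, IsCompact K → {e | (range (curve e) ∩ K).Nonempty}.Finite

namespace SurfaceEmbedding

variable {V : Type*} {G : SimpleGraph V} {S : Type*} [TopologicalSpace S]
  (X : SurfaceEmbedding G S)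

/-- The edge `e` as a subset of the surface. -/
def arc (e : G.edgeSet) : Set S := range (X.curve e)

/-- The faces: the closures of the connected components of `S ∖ ⋃ E`. -/
def faces : Set (Set S) :=
  {f | ∃ x ∈ (⋃ e, X.arc e)ᶜ, f = closure (connectedComponentIn (⋃ e, X.arc e)ᶜ x)}

/-- An embedded graph is a tessellation if (T1) every edge is included in (exactly) two faces,
(T2) any two faces are disjoint or intersect in one vertex or in one edge, and (T3) every face is
homeomorphic to a closed disc. -/
structure IsTessellation : Prop where
  two_faces : ∀ e, {f ∈ X.faces | X.arc e ⊆ f}.ncard = 2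
  inter_faces : ∀ f ∈ X.faces, ∀ f' ∈ X.faces, f ≠ f' →
    f ∩ f' = ∅ ∨ (∃ v, f ∩ f' = {X.pos v}) ∨ ∃ e, f ∩ f' = X.arc e
  disc : ∀ f ∈ X.faces,
    Nonempty (f ≃ₜ Metric.closedBall (0 : EuclideanSpace ℝ (Fin 2)) 1)

/-- The degree of a face: the number of edges included in it. (In a tessellation an edge which is
included in a face lies on the boundary of this face, being included in a second face as well.) -/
def faceDegree (f : Set S) : ℕ := {e | X.arc e ⊆ f}.ncard

/-- The end vertex `v` of an edge `e` lies on the curve `e`. -/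
theorem pos_mem_arc (e : G.edgeSet) (v : V) (hv : v ∈ (e : Sym2 V)) : X.pos v ∈ X.arc e := by
  have h : X.pos v ∈ Sym2.map X.pos (e : Sym2 V) := Sym2.mem_map.2 ⟨v, hv, rfl⟩
  rw [← X.curve_ends e, Sym2.mem_iff] at h
  rcases h with h | h
  · exact ⟨0, h.symm⟩
  · exact ⟨1, h.symm⟩

/-- A graph with a locally compact embedding is locally finite, so that an instance of
`G.LocallyFinite`, which fixes the finsets of neighbours, always exists. -/
theorem finite_neighborSet (Y : SurfaceEmbedding G S) (v : V) : (G.neighborSet v).Finite := by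
  have h := Y.locally_compact {Y.pos v} isCompact_singleton
  have h2 : ((fun e : G.edgeSet => (e : Sym2 V)) ''
      {e | (range (Y.curve e) ∩ {Y.pos v}).Nonempty}).Finite := h.image _
  refine Set.Finite.of_finite_image (f := fun w => s(v, w)) (h2.subset ?_) ?_
  · rintro _ ⟨w, hw, rfl⟩
    exact ⟨⟨s(v, w), hw⟩, ⟨Y.pos v, Y.pos_mem_arc ⟨s(v, w), hw⟩ v (by simp), rfl⟩, rfl⟩
  · intro a _ b _ hab
    exact Sym2.congr_right.1 hab

variable [G.LocallyFinite]

/-- The vertex curvature `Φ(v) = 1 - d_v / 2 + ∑_{f ∋ v} 1 / deg f`. -/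
def curvature (v : V) : ℝ :=
  1 - (G.degree v : ℝ) / 2 + ∑ᶠ f ∈ {f ∈ X.faces | X.pos v ∈ f}, 1 / (X.faceDegree f : ℝ)

/-- The supremum of the average curvatures of the finite sets of at least `n` vertices. -/
def supAverageCurvature (n : ℕ) : EReal :=
  ⨆ (W : Finset V) (_ : n ≤ W.card), (((∑ v ∈ W, X.curvature v) / (W.card : ℝ) : ℝ) : EReal)

/-- The asymptotic average curvature: the limit of the decreasing sequence
`supAverageCurvature`, see `tendsto_supAverageCurvature`. -/
def asymptoticCurvature : EReal := ⨅ n, X.supAverageCurvature n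

theorem tendsto_supAverageCurvature :
    Tendsto X.supAverageCurvature atTop (𝓝 X.asymptoticCurvature) :=
  tendsto_atTop_iInf fun _ _ hmn =>
    iSup_mono fun _ => iSup_mono' fun h => ⟨hmn.trans h, le_rfl⟩

end SurfaceEmbedding

/-! ### The combinatorial Laplacian and its spectrum -/

variable {V : Type*} (G : SimpleGraph V) [G.LocallyFinite]

/-- The formal operator `-Δ`, that is `(-Δ φ)(v) = ∑_{w ∼ v} (φ(v) - φ(w))`, on all functions. -/
def formalLaplacian : (V → ℂ) →ₗ[ℂ] (V → ℂ) where
  toFun φ v := ∑ w ∈ G.neighborFinset v, (φ v - φ w)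
  map_add' φ ψ := by
    ext v
    simp only [Pi.add_apply, ← Finset.sum_add_distrib]
    exact Finset.sum_congr rfl fun _ _ => by ring
  map_smul' c φ := by
    ext v
    simp only [Pi.smul_apply, smul_eq_mul, RingHom.id_apply, Finset.mul_sum, mul_sub]

/-- The combinatorial Laplacian `-Δ` on the Hilbert space `ℓ²(V)` with the counting measure, with
domain `D(Δ) = {φ ∈ ℓ²(V) | Δφ ∈ ℓ²(V)}`. The functions are complex-valued, since the spectrum is
a subset of `ℂ`. -/
def laplacian : lp (fun _ : V => ℂ) 2 →ₗ.[ℂ] lp (fun _ : V => ℂ) 2 where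
  domain :=
    { carrier := {φ | Memℓp (formalLaplacian G φ) 2}
      zero_mem' := by
        simpa only [mem_ofPred_eq, lp.coeFn_zero, map_zero] using zero_memℓp
      add_mem' := fun {φ ψ} hφ hψ => by
        simpa only [mem_ofPred_eq, lp.coeFn_add, map_add] using Memℓp.add hφ hψ
      smul_mem' := fun c φ hφ => by
        simpa only [mem_ofPred_eq, lp.coeFn_smul, map_smul] using Memℓp.const_smul hφ c }
  toFun :=
    { toFun := fun φ => ⟨formalLaplacian G (φ : lp (fun _ : V => ℂ) 2), φ.2⟩
      map_add' := fun φ ψ => by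
        ext1
        simp only [Submodule.coe_add, lp.coeFn_add, map_add]
      map_smul' := fun c φ => by
        ext1
        simp only [Submodule.coe_smul, lp.coeFn_smul, map_smul, RingHom.id_apply] }

/-- The spectrum of an unbounded operator `T`: the set of all `z ∈ ℂ` such that `T - z`, from the
domain of `T` to the whole space, has no bounded inverse. -/
def unboundedSpectrum {H : Type*} [NormedAddCommGroup H] [NormedSpace ℂ H] (T : H →ₗ.[ℂ] H) :
    Set ℂ :=
  {z | ¬ ∃ R : H →L[ℂ] H,
    (∀ x : T.domain, R (T x - z • (x : H)) = x) ∧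
    ∀ y : H, ∃ h : R y ∈ T.domain, T ⟨R y, h⟩ - z • R y = y}

/-- The real number `l` is the bottom (the minimum) of the spectrum of `T`: it belongs to the
spectrum, and the spectrum consists of real numbers that are at least `l`. -/
def IsBottomOfSpectrum {H : Type*} [NormedAddCommGroup H] [NormedSpace ℂ H] (T : H →ₗ.[ℂ] H)
    (l : ℝ) : Prop :=
  (l : ℂ) ∈ unboundedSpectrum T ∧ ∀ z ∈ unboundedSpectrum T, ∃ x : ℝ, z = (x : ℂ) ∧ l ≤ x

end PlanarTess

end

/-!
The idea is to turn negative curvature into a strong isoperimetric inequality, from which Cheeger's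
inequality bounds the Laplacian away from zero.

**Topology of the plane.** The only topological tool is the parity of the winding number: a nowhere
vanishing function winds an even number of times along a closed curve exactly if it has a continuous
square root there. The map `x ↦ x - p` has no square root on the image of the boundary circle of an
embedded disc around an interior point `p` (`not_hasSqrtOn_sphere`, by a homotopy to an odd
function), but it has one on an embedded disc that does not contain `p`. For a cycle `z` of edges
with coefficients modulo two, this defines a parity `wind ι p z` which is linear in `z` and locally
constant in `p` off the cycle. Hence the edges of a face form a cycle that winds around this face
and no other (`IsTessellation.exists_faceCycle`). A cycle `z` that winds around no face is zero
(`IsTessellation.eq_zero_of_wind_eq_zero`): if it contains the edge `e` of a face `f`, then the sum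
of `z` and the boundary of `f` avoids `e` and has different parities on the two sides of `e`.

**Curvature and isoperimetry.** For a finite set `W` of vertices, with `E_W`, `F_W` the edges and
faces all of whose vertices lie in `W`, a cycle in `E_W` is determined by its winding parities
around the faces in `F_W` and around the outer vertices of the edge boundary `∂W`. Comparing
dimensions gives `#E_W ≤ #W + #F_W + #∂W` (`IsTessellation.card_edges_le`), and counting gives
`∑_{v ∈ W} Φ(v) ≥ -(3/2) #∂W` (`IsTessellation.le_sum_curvature`). If the asymptotic average
curvature is negative, then `#W ≤ α #∂W` for some constant `α`; together with
`Φ(v) ≤ 1 - d_v / 6` this implies `β ∑_{v ∈ W} d_v ≤ #∂W` for some `β > 0`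
(`IsTessellation.exists_isoperimetric`). The degrees may be unbounded, so their presence on the left
is essential for the next step.

**Spectral gap.** By Cheeger's inequality, `-Δ` is bounded from below by a positive constant on the
functions of finite support. The image of these functions is dense in `ℓ²(V)`, since a function
orthogonal to it is harmonic and so vanishes by the maximum principle. Thus the inverse extends to a
positive bounded operator `A`, which inverts `-Δ` on its maximal domain, again because there are no
square summable harmonic functions (`exists_inverse_laplacian`). The bottom of the spectrum is
`1 / ‖A‖` (`isBottomOfSpectrum_of_inverse`).
-/

noncomputable section

namespace PlanarTess

/-! ### Continuous square roots -/

/-- The function `g` has a continuous square root on `K`. -/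
def HasSqrtOn {α : Type*} [TopologicalSpace α] (K : Set α) (g : α → ℂ) : Prop :=
  ∃ s : α → ℂ, ContinuousOn s K ∧ ∀ x ∈ K, s x ^ 2 = g x

theorem hasSqrtOn_of_slitPlane {α : Type*} [TopologicalSpace α] {K : Set α} {g : α → ℂ}
    (hg : ContinuousOn g K) (h : ∀ x ∈ K, g x ∈ Complex.slitPlane) : HasSqrtOn K g := by
  refine ⟨fun x => Complex.exp (Complex.log (g x) / 2), ?_, fun x hx => ?_⟩
  · exact Complex.continuous_exp.comp_continuousOn ((hg.clog h).div_const 2)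
  · rw [← Complex.exp_nat_mul]
    rw [show ((2 : ℕ) : ℂ) * (Complex.log (g x) / 2) = Complex.log (g x) by push_cast; ring]
    exact Complex.exp_log (Complex.slitPlane_ne_zero (h x hx))

/-- The quotient of two functions that are close to each other has a continuous square root. -/
theorem hasSqrtOn_div {α : Type*} [TopologicalSpace α] {K : Set α} {g₁ g₂ : α → ℂ}
    (h₁ : ContinuousOn g₁ K) (h₂ : ContinuousOn g₂ K) (h : ∀ x ∈ K, ‖g₂ x - g₁ x‖ < ‖g₁ x‖) :
    HasSqrtOn K fun x => g₂ x / g₁ x := by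
  have h0 : ∀ x ∈ K, g₁ x ≠ 0 := fun x hx => norm_pos_iff.1 ((norm_nonneg _).trans_lt (h x hx))
  refine hasSqrtOn_of_slitPlane (h₂.div h₁ h0) fun x hx => ?_
  have h3 : ‖(g₂ x - g₁ x) / g₁ x‖ < 1 := by
    rw [norm_div, div_lt_one (norm_pos_iff.2 (h0 x hx))]
    exact h x hx
  have := Complex.mem_slitPlane_of_norm_lt_one h3
  rwa [sub_div, div_self (h0 x hx), add_sub_cancel] at this

theorem HasSqrtOn.of_close {α : Type*} [TopologicalSpace α] {K : Set α} {g₁ g₂ : α → ℂ}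
    (hs : HasSqrtOn K g₁) (h₁ : ContinuousOn g₁ K) (h₂ : ContinuousOn g₂ K)
    (h : ∀ x ∈ K, ‖g₂ x - g₁ x‖ < ‖g₁ x‖) : HasSqrtOn K g₂ := by
  obtain ⟨s, hs, hs2⟩ := hs
  obtain ⟨u, hu, hu2⟩ := hasSqrtOn_div h₁ h₂ h
  refine ⟨fun x => s x * u x, hs.mul hu, fun x hx => ?_⟩
  have h0 : g₁ x ≠ 0 := norm_pos_iff.1 ((norm_nonneg _).trans_lt (h x hx))
  rw [mul_pow, hs2 x hx, hu2 x hx, mul_div_cancel₀ _ h0]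

/-- Having a continuous square root is invariant under homotopies through nowhere vanishing
functions on a compact set. -/
theorem HasSqrtOn.of_homotopy {α : Type*} [PseudoMetricSpace α] {K : Set α} (hK : IsCompact K)
    {F : α → ℝ → ℂ} (hF : ContinuousOn (Function.uncurry F) (K ×ˢ Icc (0 : ℝ) 1))
    (h0 : ∀ x ∈ K, ∀ t ∈ Icc (0 : ℝ) 1, F x t ≠ 0) (hs : HasSqrtOn K fun x => F x 0) :
    HasSqrtOn K fun x => F x 1 := by
  rcases K.eq_empty_or_nonempty with rfl | hne
  · exact ⟨0, by simp, by simp⟩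
  have hc : IsCompact (K ×ˢ Icc (0 : ℝ) 1) := hK.prod isCompact_Icc
  obtain ⟨m, hm, hmF⟩ : ∃ m > 0, ∀ x ∈ K, ∀ t ∈ Icc (0 : ℝ) 1, m ≤ ‖F x t‖ := by
    obtain ⟨p, hp, hmin⟩ := hc.exists_isMinOn (hne.prod ⟨0, by simp⟩) hF.norm
    refine ⟨‖Function.uncurry F p‖, norm_pos_iff.2 (h0 _ hp.1 _ hp.2), fun x hx t ht => ?_⟩
    exact hmin (mk_mem_prod hx ht)
  obtain ⟨δ, hδ, hu⟩ := Metric.uniformContinuousOn_iff.1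
    (hc.uniformContinuousOn_of_continuous hF) m hm
  obtain ⟨N, hN⟩ := exists_nat_one_div_lt hδ
  have hN0 : (0 : ℝ) < N + 1 := by positivity
  have hmem : ∀ i : ℕ, i ≤ N + 1 → (i : ℝ) / (N + 1) ∈ Icc (0 : ℝ) 1 := fun i hi =>
    ⟨by positivity, (div_le_one hN0).2 (by exact_mod_cast hi)⟩
  have hslice : ∀ t ∈ Icc (0 : ℝ) 1, ContinuousOn (fun x => F x t) K := fun t ht =>
    hF.comp (f := fun x => (x, t)) (by fun_prop) fun x hx => ⟨hx, ht⟩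
  have key : ∀ i : ℕ, i ≤ N + 1 → HasSqrtOn K fun x => F x ((i : ℝ) / (N + 1)) := by
    intro i
    induction i with
    | zero => intro _; simpa using hs
    | succ i ih =>
      intro hi
      have hi' : i ≤ N + 1 := by omega
      refine (ih hi').of_close (hslice _ (hmem i hi')) (hslice _ (hmem _ hi)) fun x hx => ?_
      refine lt_of_lt_of_le ?_ (hmF x hx _ (hmem i hi'))
      rw [← dist_eq_norm]
      refine hu (x, _) ⟨hx, hmem _ hi⟩ (x, _) ⟨hx, hmem i hi'⟩ ?_
      rw [Prod.dist_eq, dist_self, max_eq_right dist_nonneg, Real.dist_eq, ← sub_div]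
      push_cast
      rw [add_sub_cancel_left, abs_of_pos (by positivity)]
      exact hN
  have := key (N + 1) le_rfl
  rwa [show ((N + 1 : ℕ) : ℝ) / (N + 1) = 1 by push_cast; exact div_self hN0.ne'] at this

/-- A nowhere vanishing continuous function on a compact set that is star-shaped about the origin
has a continuous square root. -/
theorem hasSqrtOn_of_starConvex {E : Type*} [NormedAddCommGroup E] [NormedSpace ℝ E] {K : Set E}
    (hK : IsCompact K) (hstar : StarConvex ℝ 0 K) {g : E → ℂ}
    (hg : ContinuousOn g K) (h0 : ∀ x ∈ K, g x ≠ 0) : HasSqrtOn K g := by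
  have hmaps : ∀ x ∈ K, ∀ t ∈ Icc (0 : ℝ) 1, t • x ∈ K := fun x hx t ht =>
    hstar.smul_mem hx ht.1 ht.2
  have := HasSqrtOn.of_homotopy (F := fun x t => g (t • x)) hK ?_ ?_ ?_
  · simpa using this
  · exact hg.comp (f := fun p : E × ℝ => p.2 • p.1) (by fun_prop)
      fun p hp => hmaps _ hp.1 _ hp.2
  · exact fun x hx t ht => h0 _ (hmaps x hx t ht)
  · obtain ⟨c, hc⟩ := IsAlgClosed.exists_pow_nat_eq (g 0) (n := 2) (by norm_num)
    exact ⟨fun _ => c, continuousOn_const, fun x _ => by simp [hc]⟩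

/-- A nowhere vanishing odd function on a sphere has no continuous square root: this square root `s`
would satisfy `s (-x) = ε * I * s x` with a constant sign `ε`, hence `s x = (ε * I) ^ 2 * s x`. -/
theorem not_hasSqrtOn_of_odd {E : Type*} [NormedAddCommGroup E] [NormedSpace ℝ E]
    (hE : 1 < Module.rank ℝ E) {g : E → ℂ} (h0 : ∀ x ∈ Metric.sphere (0 : E) 1, g x ≠ 0)
    (hodd : ∀ x, g (-x) = - g x) : ¬ HasSqrtOn (Metric.sphere (0 : E) 1) g := by
  rintro ⟨s, hs, hs2⟩
  have hconn := isConnected_sphere hE (0 : E) zero_le_one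
  have hneg : ∀ x ∈ Metric.sphere (0 : E) 1, -x ∈ Metric.sphere (0 : E) 1 := fun x hx => by
    simpa using hx
  obtain ⟨x, hx⟩ := hconn.nonempty
  have hs0 : ∀ y ∈ Metric.sphere (0 : E) 1, s y ≠ 0 := fun y hy h =>
    h0 y hy (by rw [← hs2 y hy, h]; simp)
  have hsn : ContinuousOn (fun x => s (-x)) (Metric.sphere (0 : E) 1) :=
    hs.comp (by fun_prop) hneg
  have hsq : EqOn ((fun x => s (-x)) ^ 2) ((fun x => Complex.I * s x) ^ 2)
      (Metric.sphere (0 : E) 1) := by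
    intro y hy
    simp only [Pi.pow_apply, mul_pow, Complex.I_sq]
    rw [hs2 _ (hneg y hy), hodd, hs2 y hy]
    ring
  have h2 : Complex.I * (Complex.I * s x) = - s x := by
    rw [← mul_assoc, Complex.I_mul_I]; ring
  have h3 : s x ≠ - s x := fun h => hs0 x hx (self_eq_neg.1 h)
  rcases hconn.isPreconnected.eq_or_eq_neg_of_sq_eq hsn (continuousOn_const.mul hs) hsq
    (fun {y} hy => mul_ne_zero Complex.I_ne_zero (hs0 y hy)) with h | h
  · have h4 := h hx
    have h5 := h (hneg x hx)
    simp only [neg_neg, Pi.mul_apply] at h4 h5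
    rw [h4, h2] at h5
    exact h3 h5
  · have h4 := h hx
    have h5 := h (hneg x hx)
    simp only [neg_neg, Pi.neg_apply, Pi.mul_apply] at h4 h5
    rw [h4, mul_neg, h2, neg_neg] at h5
    exact h3 (by simpa using h5)

/-- An injective image of a circle winds an odd number of times around the image of each interior
point of the disc: the difference `h x - h y` is homotopic to the odd function `h x - h (-x)`. -/
theorem not_hasSqrtOn_sphere {E : Type*} [NormedAddCommGroup E] [NormedSpace ℝ E]
    [ProperSpace E] (hE : 1 < Module.rank ℝ E) {h : E → ℂ}
    (hc : ContinuousOn h (Metric.closedBall 0 1)) (hi : InjOn h (Metric.closedBall 0 1)) {y : E}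
    (hy : y ∈ Metric.ball (0 : E) 1) :
    ¬ HasSqrtOn (Metric.sphere (0 : E) 1) fun x => h x - h y := by
  intro hs
  have hsub : Metric.sphere (0 : E) 1 ⊆ Metric.closedBall 0 1 := Metric.sphere_subset_closedBall
  have hy' : ‖y‖ < 1 := by simpa using hy
  have hmaps : ∀ x ∈ Metric.sphere (0 : E) 1, ∀ t ∈ Icc (0 : ℝ) 1,
      (1 - t) • y - t • x ∈ Metric.closedBall (0 : E) 1 := by
    intro x hx t ht
    have hx' : ‖x‖ = 1 := by simpa using hx
    rw [mem_closedBall_zero_iff]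
    calc ‖(1 - t) • y - t • x‖ ≤ ‖(1 - t) • y‖ + ‖t • x‖ := norm_sub_le _ _
      _ = (1 - t) * ‖y‖ + t := by
        rw [norm_smul, norm_smul, hx', Real.norm_of_nonneg ht.1,
          Real.norm_of_nonneg (sub_nonneg.2 ht.2), mul_one]
      _ ≤ 1 := by nlinarith [ht.1, ht.2]
  have key := HasSqrtOn.of_homotopy (F := fun x t => h x - h ((1 - t) • y - t • x))
    (isCompact_sphere (0 : E) 1) ?_ ?_ (by simpa using hs)
  · simp only [sub_self, zero_smul, one_smul, zero_sub] at key
    refine not_hasSqrtOn_of_odd hE (g := fun x => h x - h (-x)) ?_ ?_ key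
    · intro x hx h2
      have := hi (hsub hx) (hsub (by simpa using hx)) (sub_eq_zero.1 h2)
      have h3 : (2 : ℝ) • x = 0 := by
        rw [two_smul]
        nth_rewrite 1 [this]
        exact neg_add_cancel x
      have hx0 : x = 0 := (smul_eq_zero.1 h3).resolve_left two_ne_zero
      simp [hx0] at hx
    · intro x; simp
  · refine ContinuousOn.sub (hc.comp continuousOn_fst fun p hp => hsub hp.1) ?_
    exact hc.comp (f := fun p : E × ℝ => (1 - p.2) • y - p.2 • p.1) (by fun_prop)
      fun p hp => hmaps _ hp.1 _ hp.2
  · intro x hx t ht h2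
    have h3 := hi (hsub hx) (hmaps x hx t ht) (sub_eq_zero.1 h2)
    have hx' : ‖x‖ = 1 := by simpa using hx
    have h4 : (1 + t) • x = (1 - t) • y := by
      rw [add_smul, one_smul]
      nth_rewrite 1 [h3]
      abel
    have h5 := congrArg norm h4
    rw [norm_smul, norm_smul, hx', Real.norm_of_nonneg (by linarith [ht.1]),
      Real.norm_of_nonneg (sub_nonneg.2 ht.2), mul_one] at h5
    nlinarith [ht.1, ht.2, norm_nonneg y]

/-- An injective continuous map from an open subset of the plane into the closed unit disc avoids
the unit circle. Otherwise the image of a small circle about the preimage of a boundary point would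
lie in a half plane bounded by this point, so it could not wind around this point. -/
theorem mem_ball_of_injOn {U : Set ℂ} (hU : IsOpen U) {k : ℂ → ℂ} (hc : ContinuousOn k U)
    (hi : InjOn k U) (hk : MapsTo k U (Metric.closedBall 0 1)) {x : ℂ} (hx : x ∈ U) :
    k x ∈ Metric.ball (0 : ℂ) 1 := by
  by_contra hnot
  have hkx : ‖k x‖ = 1 := by
    have h1 := hk hx
    rw [mem_closedBall_zero_iff] at h1
    rw [mem_ball_zero_iff, not_lt] at hnot
    exact le_antisymm h1 hnot
  obtain ⟨r, hr, hrU⟩ := Metric.nhds_basis_closedBall.mem_iff.1 (hU.mem_nhds hx)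
  have hmaps : MapsTo (fun w : ℂ => x + r * w) (Metric.closedBall 0 1) U := by
    intro w hw
    apply hrU
    rw [mem_closedBall_zero_iff] at hw
    rw [Metric.mem_closedBall, dist_eq_norm, add_sub_cancel_left, norm_mul, Complex.norm_real,
      Real.norm_of_nonneg hr.le]
    exact mul_le_of_le_one_right hr.le hw
  have hr' : (r : ℂ) ≠ 0 := by exact_mod_cast hr.ne'
  have hinj : InjOn (fun w : ℂ => k (x + r * w)) (Metric.closedBall 0 1) := by
    intro a ha b hb hab
    have := hi (hmaps ha) (hmaps hb) hab
    exact mul_left_cancel₀ hr' (add_left_cancel this)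
  have hcont : ContinuousOn (fun w : ℂ => k (x + r * w)) (Metric.closedBall 0 1) :=
    hc.comp (by fun_prop) hmaps
  have hrank : 1 < Module.rank ℝ ℂ := by rw [Complex.rank_real_complex]; norm_num
  refine not_hasSqrtOn_sphere hrank hcont hinj (y := 0) (by simp) ?_
  have hsub : Metric.sphere (0 : ℂ) 1 ⊆ Metric.closedBall 0 1 := Metric.sphere_subset_closedBall
  -- after division by `-k x` the values lie in the right half plane
  have hkx0 : - k x ≠ 0 := by rw [neg_ne_zero]; exact norm_pos_iff.1 (by rw [hkx]; norm_num)
  have hslit : HasSqrtOn (Metric.sphere (0 : ℂ) 1) fun w => (k (x + r * w) - k x) / - k x := by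
    refine hasSqrtOn_of_slitPlane (((hcont.mono hsub).sub continuousOn_const).div_const _) ?_
    intro w hw
    left
    have hne : k (x + r * w) ≠ k x := by
      intro h
      have := hinj (hsub hw) (by simp : (0 : ℂ) ∈ Metric.closedBall (0 : ℂ) 1) (by simpa using h)
      simp [this] at hw
    have hle : ‖k (x + r * w)‖ ≤ 1 := mem_closedBall_zero_iff.1 (hk (hmaps (hsub hw)))
    set a := k (x + r * w)
    set b := k x
    have hb0 : b ≠ 0 := by simpa using hkx0
    have hq : (a - b) / -b = 1 - a / b := by field_simp; ring
    have hqn : ‖a / b‖ ≤ 1 := by rw [norm_div, hkx, div_one]; exact hle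
    rw [hq, Complex.sub_re, Complex.one_re, sub_pos]
    refine lt_of_le_of_ne ((Complex.re_le_norm _).trans hqn) fun h1 => ?_
    have h2 : (a / b) = 1 := by
      have h3 : Complex.normSq (a / b) ≤ 1 := by
        rw [Complex.normSq_eq_norm_sq]; nlinarith [norm_nonneg (a / b)]
      rw [Complex.normSq_apply, h1] at h3
      apply Complex.ext
      · simpa using h1
      · simp only [Complex.one_im]; nlinarith
    exact hne ((div_eq_one_iff_eq hb0).1 h2)
  obtain ⟨s, hs, hs2⟩ := hslit
  obtain ⟨c, hcc⟩ := IsAlgClosed.exists_pow_nat_eq (- k x) (n := 2) (by norm_num)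
  refine ⟨fun w => s w * c, hs.mul continuousOn_const, fun w hw => ?_⟩
  rw [mul_pow, hs2 w hw, hcc, div_mul_cancel₀ _ hkx0]
  simp

/-! ### Chains modulo two and the winding parity -/

/-- A functional that vanishes on the part of the kernel of `B` in the subspace `M'` factors through
`B` on `M'`. -/
theorem exists_dual_comp_eq {K M N : Type*} [Field K] [AddCommGroup M] [Module K M]
    [AddCommGroup N] [Module K N] (B : M →ₗ[K] N) (f : M →ₗ[K] K) (M' : Submodule K M)
    (h : ∀ x ∈ M', B x = 0 → f x = 0) : ∃ φ : N →ₗ[K] K, ∀ x ∈ M', φ (B x) = f x := by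
  have hker : f.domRestrict M' ∈ (LinearMap.ker (B.domRestrict M')).dualAnnihilator := by
    rw [Submodule.mem_dualAnnihilator]
    exact fun z hz => h z z.2 hz
  rw [← LinearMap.range_dualMap_eq_dualAnnihilator_ker] at hker
  obtain ⟨φ, hφ⟩ := hker
  exact ⟨φ, fun x hx => LinearMap.congr_fun hφ ⟨x, hx⟩⟩

/-- A chosen square root of a complex number. -/
def root (z : ℂ) : ℂ := (IsAlgClosed.exists_pow_nat_eq z (n := 2) (by norm_num)).choose

theorem root_sq (z : ℂ) : root z ^ 2 = z :=
  (IsAlgClosed.exists_pow_nat_eq z (n := 2) (by norm_num)).choose_spec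

theorem root_ne_zero {z : ℂ} (hz : z ≠ 0) : root z ≠ 0 := fun h => hz (by
  rw [← root_sq z, h]; simp)

/-- The sign `(-1) ^ a`. -/
def sgn (a : ZMod 2) : ℂ := if a = 0 then 1 else -1

theorem zmod_two_eq (a : ZMod 2) : a = 0 ∨ a = 1 := by
  revert a; decide

theorem zmod_two_add_self (a : ZMod 2) : a + a = 0 := by
  revert a; decide

@[simp] theorem sgn_zero : sgn 0 = 1 := by simp [sgn]

@[simp] theorem sgn_one : sgn 1 = -1 := by simp [sgn]

theorem sgn_add (a b : ZMod 2) : sgn (a + b) = sgn a * sgn b := by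
  rcases zmod_two_eq a with rfl | rfl <;> rcases zmod_two_eq b with rfl | rfl <;>
    simp [zmod_two_add_self]

theorem sgn_mul_self (a : ZMod 2) : sgn a * sgn a = 1 := by
  rw [← sgn_add, zmod_two_add_self, sgn_zero]

theorem sgn_injective : Function.Injective sgn := by
  intro a b h
  rcases zmod_two_eq a with rfl | rfl <;> rcases zmod_two_eq b with rfl | rfl <;>
    first | rfl | (exfalso; norm_num at h)

theorem exists_sgn_of_sq_eq {a b : ℂ} (h : a ^ 2 = b ^ 2) : ∃ c, a = sgn c * b := by
  rcases sq_eq_sq_iff_eq_or_eq_neg.1 h with h | h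
  · exact ⟨0, by simpa using h⟩
  · exact ⟨1, by simpa using h⟩

theorem exists_sgn_of_sq_eq_interval {s s' : unitInterval → ℂ} (hs : Continuous s)
    (hs' : Continuous s') (h : ∀ t, s t ^ 2 = s' t ^ 2) (h0 : ∀ t, s' t ≠ 0) :
    ∃ c, ∀ t, s t = sgn c * s' t := by
  rcases isPreconnected_univ.eq_or_eq_neg_of_sq_eq hs.continuousOn hs'.continuousOn
    (fun t _ => h t) (fun {t} _ => h0 t) with h | h
  · exact ⟨0, fun t => by simpa using h (mem_univ t)⟩
  · exact ⟨1, fun t => by simpa using h (mem_univ t)⟩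

namespace SurfaceEmbedding

variable {V : Type*} {G : SimpleGraph V} {S : Type*} [TopologicalSpace S]
  (X : SurfaceEmbedding G S)

theorem exists_ends (e : G.edgeSet) : ∃ p : V × V, (e : Sym2 V) = s(p.1, p.2) ∧
    X.curve e 0 = X.pos p.1 ∧ X.curve e 1 = X.pos p.2 := by
  obtain ⟨⟨a, b⟩, hab⟩ := Quot.exists_rep (e : Sym2 V)
  have hab' : (e : Sym2 V) = s(a, b) := hab.symm
  have h := X.curve_ends e
  rw [hab', Sym2.map_mk, Sym2.eq_iff] at h
  rcases h with h | h
  · exact ⟨(a, b), hab', h⟩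
  · exact ⟨(b, a), hab'.trans Sym2.eq_swap, h⟩

/-- The vertex at which the curve `e` starts. -/
def src (e : G.edgeSet) : V := (X.exists_ends e).choose.1

/-- The vertex at which the curve `e` ends. -/
def tgt (e : G.edgeSet) : V := (X.exists_ends e).choose.2

theorem edge_eq (e : G.edgeSet) : (e : Sym2 V) = s(X.src e, X.tgt e) :=
  (X.exists_ends e).choose_spec.1

theorem curve_zero (e : G.edgeSet) : X.curve e 0 = X.pos (X.src e) :=
  (X.exists_ends e).choose_spec.2.1

theorem curve_one (e : G.edgeSet) : X.curve e 1 = X.pos (X.tgt e) :=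
  (X.exists_ends e).choose_spec.2.2

theorem mem_edge_iff (e : G.edgeSet) (v : V) :
    v ∈ (e : Sym2 V) ↔ v = X.src e ∨ v = X.tgt e := by
  rw [X.edge_eq e, Sym2.mem_iff]

theorem src_mem (e : G.edgeSet) : X.src e ∈ (e : Sym2 V) := (X.mem_edge_iff e _).2 (Or.inl rfl)

theorem tgt_mem (e : G.edgeSet) : X.tgt e ∈ (e : Sym2 V) := (X.mem_edge_iff e _).2 (Or.inr rfl)

theorem adj_src_tgt (e : G.edgeSet) : G.Adj (X.src e) (X.tgt e) := by
  rw [← SimpleGraph.mem_edgeSet, ← X.edge_eq e]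
  exact e.2

theorem src_ne_tgt (e : G.edgeSet) : X.src e ≠ X.tgt e := (X.adj_src_tgt e).ne

theorem pos_mem_arc_iff (e : G.edgeSet) (v : V) : X.pos v ∈ X.arc e ↔ v ∈ (e : Sym2 V) :=
  ⟨fun ⟨t, ht⟩ => X.vertex_on_curve v e t ht, X.pos_mem_arc e v⟩

theorem isCompact_arc (e : G.edgeSet) : IsCompact (X.arc e) :=
  isCompact_range (X.curve_continuous e)

/-- The boundary of a chain of edges with coefficients in the field with two elements. -/
def bdry : (G.edgeSet →₀ ZMod 2) →ₗ[ZMod 2] (V →₀ ZMod 2) :=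
  Finsupp.linearCombination (ZMod 2) fun e =>
    Finsupp.single (X.src e) 1 + Finsupp.single (X.tgt e) 1

/-- The union of the arcs of the edges of a chain. -/
def carrier (z : G.edgeSet →₀ ZMod 2) : Set S := ⋃ e ∈ z.support, X.arc e

theorem isCompact_carrier (z : G.edgeSet →₀ ZMod 2) : IsCompact (X.carrier z) :=
  z.support.isCompact_biUnion fun e _ => X.isCompact_arc e

theorem arc_subset_carrier {z : G.edgeSet →₀ ZMod 2} {e : G.edgeSet} (he : e ∈ z.support) :
    X.arc e ⊆ X.carrier z := subset_biUnion_of_mem (u := fun e => X.arc e) he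

/-- Whether the chosen square roots of the values of `g` at the ends of the edge `e` belong to the
same continuous square root of `g` along `e` (parity `0`) or not (parity `1`). -/
def edgeParity (g : S → ℂ) (e : G.edgeSet) : ZMod 2 :=
  open Classical in
  if ∃ s : unitInterval → ℂ, Continuous s ∧ (∀ t, s t ^ 2 = g (X.curve e t)) ∧
    s 0 = root (g (X.pos (X.src e))) ∧ s 1 = root (g (X.pos (X.tgt e))) then 0 else 1

theorem exists_sqrt_curve {g : S → ℂ} {e : G.edgeSet} (hg : ContinuousOn g (X.arc e))
    (h0 : ∀ x ∈ X.arc e, g x ≠ 0) :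
    ∃ s : unitInterval → ℂ, Continuous s ∧ (∀ t, s t ^ 2 = g (X.curve e t)) ∧
      s 0 = root (g (X.pos (X.src e))) := by
  have hgc : Continuous fun t => g (X.curve e t) :=
    hg.comp_continuous (X.curve_continuous e) fun t => mem_range_self t
  obtain ⟨s, hs, hs2⟩ := hasSqrtOn_of_starConvex (K := Icc (0 : ℝ) 1) isCompact_Icc
    ((convex_Icc 0 1).starConvex (by simp))
    (g := fun t => g (X.curve e (projIcc 0 1 zero_le_one t)))
    (hgc.comp continuous_projIcc).continuousOn (fun t _ => h0 _ (mem_range_self _))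
  have hs3 : ∀ t : unitInterval, s t ^ 2 = g (X.curve e t) := fun t => by
    simp only [hs2 t t.2, projIcc_val]
  obtain ⟨c, hc⟩ := exists_sgn_of_sq_eq (a := root (g (X.pos (X.src e))))
    (b := s (0 : unitInterval)) (by rw [root_sq, hs3, X.curve_zero])
  refine ⟨fun t => sgn c * s t, continuous_const.mul
    (hs.comp_continuous continuous_subtype_val fun t => t.2), fun t => ?_, hc.symm⟩
  rw [mul_pow, sq (sgn c), sgn_mul_self, one_mul, hs3]

theorem edgeParity_spec {g : S → ℂ} {e : G.edgeSet} (hg : ContinuousOn g (X.arc e))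
    (h0 : ∀ x ∈ X.arc e, g x ≠ 0) :
    ∃ s : unitInterval → ℂ, Continuous s ∧ (∀ t, s t ^ 2 = g (X.curve e t)) ∧
      s 0 = root (g (X.pos (X.src e))) ∧
      s 1 = sgn (X.edgeParity g e) * root (g (X.pos (X.tgt e))) := by
  obtain ⟨s, hs, hs2, hs0⟩ := X.exists_sqrt_curve hg h0
  refine ⟨s, hs, hs2, hs0, ?_⟩
  obtain ⟨c, hc⟩ := exists_sgn_of_sq_eq (a := s 1) (b := root (g (X.pos (X.tgt e))))
    (by rw [root_sq, hs2, X.curve_one])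
  rcases zmod_two_eq c with rfl | rfl
  · rw [edgeParity, if_pos ⟨s, hs, hs2, hs0, by simpa using hc⟩, hc]
  · rw [edgeParity, if_neg, hc]
    rintro ⟨s', hs', hs2', hs0', hs1'⟩
    have hne : ∀ t, s t ≠ 0 := fun t h => h0 (X.curve e t) (mem_range_self t) (by
      rw [← hs2, h]; simp)
    obtain ⟨a, ha⟩ := exists_sgn_of_sq_eq_interval hs' hs (fun t => by rw [hs2, hs2']) hne
    have h1 := ha 0
    rw [hs0', ← hs0, eq_comm, mul_eq_right₀ (hne 0)] at h1
    have h2 := ha 1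
    rw [h1, one_mul, hs1', hc, sgn_one, neg_one_mul, self_eq_neg] at h2
    refine root_ne_zero (h0 _ ?_) h2
    exact ⟨1, X.curve_one e⟩

theorem edgeParity_eq_add {g : S → ℂ} {e : G.edgeSet} (hg : ContinuousOn g (X.arc e))
    (h0 : ∀ x ∈ X.arc e, g x ≠ 0) {s : unitInterval → ℂ} (hs : Continuous s)
    (hs2 : ∀ t, s t ^ 2 = g (X.curve e t)) {a b : ZMod 2}
    (ha : s 0 = sgn a * root (g (X.pos (X.src e))))
    (hb : s 1 = sgn b * root (g (X.pos (X.tgt e)))) : X.edgeParity g e = a + b := by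
  obtain ⟨s', hs', hs2', hs0', hs1'⟩ := X.edgeParity_spec hg h0
  have hne : ∀ t, s' t ≠ 0 := fun t h => h0 (X.curve e t) (mem_range_self t) (by
    rw [← hs2', h]; simp)
  obtain ⟨c, hc⟩ := exists_sgn_of_sq_eq_interval hs hs' (fun t => by rw [hs2, hs2']) hne
  have h1 := hc 0
  rw [ha, ← hs0'] at h1
  have hca := sgn_injective (mul_right_cancel₀ (hne 0) h1)
  have h2 := hc 1
  have hr : root (g (X.pos (X.tgt e))) ≠ 0 := root_ne_zero (h0 _ ⟨1, X.curve_one e⟩)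
  rw [hb, hs1', ← mul_assoc, ← sgn_add] at h2
  have hcb := sgn_injective (mul_right_cancel₀ hr h2)
  rw [hcb, hca, ← add_assoc, zmod_two_add_self, zero_add]

/-- The total parity of a chain. If the chain is a cycle, this is the parity of the number of times
that `g` winds around the origin along it. -/
def windParity (g : S → ℂ) : (G.edgeSet →₀ ZMod 2) →ₗ[ZMod 2] ZMod 2 :=
  Finsupp.linearCombination (ZMod 2) (X.edgeParity g)

theorem linearCombination_bdry (c : V → ZMod 2) (z : G.edgeSet →₀ ZMod 2) :
    Finsupp.linearCombination (ZMod 2) (fun e => c (X.src e) + c (X.tgt e)) z =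
      Finsupp.linearCombination (ZMod 2) c (X.bdry z) := by
  have : Finsupp.linearCombination (ZMod 2) (fun e => c (X.src e) + c (X.tgt e)) =
      Finsupp.linearCombination (ZMod 2) c ∘ₗ X.bdry := by
    ext e
    simp [bdry]
  rw [this]; rfl

theorem windParity_congr {g₁ g₂ : S → ℂ} {z : G.edgeSet →₀ ZMod 2} (hz : X.bdry z = 0)
    {c : V → ZMod 2} (h : ∀ e ∈ z.support,
      X.edgeParity g₂ e = X.edgeParity g₁ e + (c (X.src e) + c (X.tgt e))) :
    X.windParity g₂ z = X.windParity g₁ z := by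
  have h1 := X.linearCombination_bdry c z
  rw [hz, map_zero] at h1
  rw [windParity, windParity, ← add_zero (Finsupp.linearCombination (ZMod 2) (X.edgeParity g₁) z),
    ← h1]
  simp only [Finsupp.linearCombination_apply, Finsupp.sum, ← Finset.sum_add_distrib, ← smul_add]
  exact Finset.sum_congr rfl fun e he => by rw [h e he]

theorem windParity_eq_of_hasSqrtOn_div {g₁ g₂ : S → ℂ} {z : G.edgeSet →₀ ZMod 2}
    (hz : X.bdry z = 0) (h₁ : ContinuousOn g₁ (X.carrier z)) (h₂ : ContinuousOn g₂ (X.carrier z))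
    (h₁0 : ∀ x ∈ X.carrier z, g₁ x ≠ 0) (h₂0 : ∀ x ∈ X.carrier z, g₂ x ≠ 0)
    (hs : HasSqrtOn (X.carrier z) fun x => g₂ x / g₁ x) :
    X.windParity g₂ z = X.windParity g₁ z := by
  classical
  obtain ⟨u, hu, hu2⟩ := hs
  have hprod : ∀ x ∈ X.carrier z, u x ^ 2 * g₁ x = g₂ x := fun x hx => by
    rw [hu2 x hx, div_mul_cancel₀ _ (h₁0 x hx)]
  have hc : ∀ v : V, ∃ c, X.pos v ∈ X.carrier z →
      u (X.pos v) * root (g₁ (X.pos v)) = sgn c * root (g₂ (X.pos v)) := by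
    intro v
    by_cases hv : X.pos v ∈ X.carrier z
    · obtain ⟨c, hc⟩ := exists_sgn_of_sq_eq (a := u (X.pos v) * root (g₁ (X.pos v)))
        (b := root (g₂ (X.pos v))) (by rw [mul_pow, root_sq, root_sq, hprod _ hv])
      exact ⟨c, fun _ => hc⟩
    · exact ⟨0, fun h => absurd h hv⟩
  choose c hc using hc
  refine X.windParity_congr hz (c := c) fun e he => ?_
  have hsub := X.arc_subset_carrier he
  obtain ⟨s, hs, hs2, hs0, hs1⟩ := X.edgeParity_spec (h₁.mono hsub) fun x hx => h₁0 x (hsub hx)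
  have hsrc : X.pos (X.src e) ∈ X.carrier z := hsub (X.pos_mem_arc e _ (X.src_mem e))
  have htgt : X.pos (X.tgt e) ∈ X.carrier z := hsub (X.pos_mem_arc e _ (X.tgt_mem e))
  rw [X.edgeParity_eq_add (h₂.mono hsub) (fun x hx => h₂0 x (hsub hx))
    (s := fun t => u (X.curve e t) * s t) (a := c (X.src e))
    (b := X.edgeParity g₁ e + c (X.tgt e)) ?_ ?_ ?_ ?_]
  · ring
  · exact ((hu.mono hsub).comp_continuous (X.curve_continuous e) fun t => mem_range_self t).mul hs
  · intro t
    rw [mul_pow, hs2, hprod _ (hsub (mem_range_self t))]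
  · rw [hs0, X.curve_zero, hc _ hsrc]
  · rw [hs1, X.curve_one, sgn_add, mul_assoc, ← hc _ htgt]
    ring

theorem windParity_eq_zero {g : S → ℂ} {z : G.edgeSet →₀ ZMod 2}
    (hz : X.bdry z = 0) (hg : ContinuousOn g (X.carrier z)) (h0 : ∀ x ∈ X.carrier z, g x ≠ 0)
    (hs : HasSqrtOn (X.carrier z) g) : X.windParity g z = 0 := by
  rw [X.windParity_eq_of_hasSqrtOn_div (g₁ := fun _ => 1) hz continuousOn_const hg (by simp) h0
    (by simpa using hs)]
  have h1 : ∀ e, X.edgeParity (fun _ => (1 : ℂ)) e = 0 := fun e => by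
    rw [X.edgeParity_eq_add (s := fun _ => root 1) (a := 0) (b := 0) continuousOn_const (by simp)
      continuous_const (fun t => root_sq 1) (by simp) (by simp), add_zero]
  simp [windParity, Finsupp.linearCombination_apply, h1]

/-- If no cycle in a set of edges is wound around by `g`, then the square roots of `g` along
these edges fit together at the vertices. -/
theorem exists_potential {g : S → ℂ} (E₀ : Set G.edgeSet)
    (h : ∀ z : G.edgeSet →₀ ZMod 2, ↑z.support ⊆ E₀ → X.bdry z = 0 → X.windParity g z = 0) :
    ∃ c : V → ZMod 2, ∀ e ∈ E₀, X.edgeParity g e = c (X.src e) + c (X.tgt e) := by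
  obtain ⟨φ, hφ⟩ := exists_dual_comp_eq X.bdry (X.windParity g)
    (Finsupp.supported (ZMod 2) (ZMod 2) E₀) h
  refine ⟨fun v => φ (Finsupp.single v 1), fun e he => ?_⟩
  have := hφ _ (Finsupp.single_mem_supported _ 1 he)
  simpa [bdry, windParity, eq_comm] using this

/-! ### Winding parity around points -/

/-- The parity of the number of times that a cycle winds around the point `p` of the surface, which
is identified with the complex plane by `ι`. -/
def wind (ι : S ≃ₜ ℂ) (p : S) : (G.edgeSet →₀ ZMod 2) →ₗ[ZMod 2] ZMod 2 :=
  X.windParity fun x => ι x - ι p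

theorem wind_eventuallyEq (ι : S ≃ₜ ℂ) {z : G.edgeSet →₀ ZMod 2} (hz : X.bdry z = 0) {p : S}
    (hp : p ∉ X.carrier z) : ∀ᶠ q in 𝓝 p, X.wind ι q z = X.wind ι p z := by
  have hcl : IsClosed (ι '' X.carrier z) := ((X.isCompact_carrier z).image ι.continuous).isClosed
  have hnot : ι p ∈ (ι '' X.carrier z)ᶜ := fun ⟨x, hx, hxp⟩ => hp (ι.injective hxp ▸ hx)
  obtain ⟨δ, hδ, hball⟩ := Metric.isOpen_iff.1 hcl.isOpen_compl _ hnot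
  have hdist : ∀ x ∈ X.carrier z, δ ≤ ‖ι x - ι p‖ := by
    intro x hx
    by_contra! hlt
    exact hball (by rwa [Metric.mem_ball, dist_eq_norm]) ⟨x, hx, rfl⟩
  filter_upwards [ι.continuous.continuousAt.preimage_mem_nhds (Metric.ball_mem_nhds (ι p) hδ)]
    with q hq
  rw [mem_preimage, Metric.mem_ball, dist_eq_norm] at hq
  have hc : ∀ q : S, ContinuousOn (fun x => ι x - ι q) (X.carrier z) := fun q => by
    have := ι.continuous
    fun_prop
  have hlt : ∀ x ∈ X.carrier z, ‖(ι x - ι q) - (ι x - ι p)‖ < ‖ι x - ι p‖ := fun x hx => by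
    rw [sub_sub_sub_cancel_left, norm_sub_rev]
    exact hq.trans_le (hdist x hx)
  refine X.windParity_eq_of_hasSqrtOn_div hz (hc p) (hc q) ?_ ?_ (hasSqrtOn_div (hc p) (hc q) hlt)
  · exact fun x hx h => absurd (hdist x hx) (by rw [h, norm_zero]; exact not_le.2 hδ)
  · intro x hx h
    have := hlt x hx
    rw [h, zero_sub, norm_neg] at this
    exact lt_irrefl _ this

theorem wind_eq_of_isPreconnected (ι : S ≃ₜ ℂ) {z : G.edgeSet →₀ ZMod 2} (hz : X.bdry z = 0)
    {C : Set S} (hC : IsPreconnected C) (hd : Disjoint C (X.carrier z)) {p q : S} (hp : p ∈ C)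
    (hq : q ∈ C) : X.wind ι p z = X.wind ι q z := by
  let _ : TopologicalSpace (ZMod 2) := ⊥
  have _ : DiscreteTopology (ZMod 2) := ⟨rfl⟩
  refine hC.constant (f := fun p => X.wind ι p z) (fun x hx => ?_) hp hq
  refine ContinuousAt.continuousWithinAt ?_
  have h : (fun p => X.wind ι p z) =ᶠ[𝓝 x] fun _ => X.wind ι x z :=
    X.wind_eventuallyEq ι hz (disjoint_left.1 hd hx)
  exact continuousAt_const.congr h.symm

theorem wind_eq_of_mem_closure (ι : S ≃ₜ ℂ) {z : G.edgeSet →₀ ZMod 2} (hz : X.bdry z = 0)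
    {C : Set S} (hC : IsPreconnected C) (hd : Disjoint C (X.carrier z)) {p q : S} (hp : p ∈ C)
    (hq : q ∈ closure C) (hqz : q ∉ X.carrier z) : X.wind ι p z = X.wind ι q z := by
  obtain ⟨x, hx, hxC⟩ := mem_closure_iff_nhds.1 hq _ (X.wind_eventuallyEq ι hz hqz)
  rw [← mem_ofPred_eq.mp hx]
  exact X.wind_eq_of_isPreconnected ι hz hC hd hp hxC

end SurfaceEmbedding

namespace SurfaceEmbedding

variable {V : Type*} {G : SimpleGraph V} {S : Type*} [TopologicalSpace S]
  (X : SurfaceEmbedding G S)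

/-! ### Edges and faces -/

theorem curve_eq_pos {e : G.edgeSet} {v : V} (hv : v ∈ (e : Sym2 V)) {t : unitInterval}
    (ht : X.curve e t = X.pos v) : (t = 0 ∧ v = X.src e) ∨ (t = 1 ∧ v = X.tgt e) := by
  rcases (X.mem_edge_iff e v).1 hv with rfl | rfl
  · exact Or.inl ⟨X.curve_injective e (ht.trans (X.curve_zero e).symm), rfl⟩
  · exact Or.inr ⟨X.curve_injective e (ht.trans (X.curve_one e).symm), rfl⟩

/-- A point in the interior of the edge `e`. -/
def midpoint (e : G.edgeSet) : S := X.curve e ⟨1 / 2, by norm_num, by norm_num⟩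

theorem midpoint_mem_arc (e : G.edgeSet) : X.midpoint e ∈ X.arc e := mem_range_self _

theorem midpoint_ne_pos (e : G.edgeSet) (v : V) : X.midpoint e ≠ X.pos v := by
  intro h
  rcases X.curve_eq_pos (X.vertex_on_curve v e _ h) h with ⟨h, -⟩ | ⟨h, -⟩
  · have := congrArg Subtype.val h
    norm_num at this
  · have := congrArg Subtype.val h
    norm_num at this

theorem eq_of_mem_arc {e e' : G.edgeSet} {x : S} (he : x ∈ X.arc e) (he' : x ∈ X.arc e')
    (hx : ∀ v, x ≠ X.pos v) : e = e' := by
  by_contra hne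
  obtain ⟨t, rfl⟩ := he
  obtain ⟨t', ht'⟩ := he'
  obtain ⟨v, -, -, hv⟩ := X.curves_meet e e' t t' hne ht'.symm
  exact hx v hv

theorem eq_of_midpoint_mem_arc {e e' : G.edgeSet} (h : X.midpoint e ∈ X.arc e') : e = e' :=
  X.eq_of_mem_arc (X.midpoint_mem_arc e) h (X.midpoint_ne_pos e)

theorem midpoint_notMem_carrier {e : G.edgeSet} {z : G.edgeSet →₀ ZMod 2} (he : z e = 0) :
    X.midpoint e ∉ X.carrier z := by
  intro h
  simp only [carrier, mem_iUnion] at h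
  obtain ⟨e', he', h⟩ := h
  rw [← X.eq_of_midpoint_mem_arc h] at he'
  exact Finsupp.mem_support_iff.1 he' he

/-- The union of all edges. -/
def edgeUnion : Set S := ⋃ e, X.arc e

theorem arc_subset_edgeUnion (e : G.edgeSet) : X.arc e ⊆ X.edgeUnion := subset_iUnion X.arc e

theorem carrier_subset_edgeUnion (z : G.edgeSet →₀ ZMod 2) : X.carrier z ⊆ X.edgeUnion :=
  iUnion₂_subset fun e _ => X.arc_subset_edgeUnion e

theorem isClosed_edgeUnion [T2Space S] [LocallyCompactSpace S] : IsClosed X.edgeUnion := by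
  refine LocallyFinite.isClosed_iUnion (fun x => ?_) fun e => (X.isCompact_arc e).isClosed
  obtain ⟨K, hK, hx⟩ := exists_compact_mem_nhds x
  exact ⟨K, hx, X.locally_compact K hK⟩

/-- The component of the complement of the edges whose closure is the face `f`. -/
def cell (f : X.faces) : Set S := connectedComponentIn X.edgeUnionᶜ f.2.choose

/-- A point in the interior of the face `f`. -/
def facePoint (f : X.faces) : S := f.2.choose

theorem facePoint_mem_cell (f : X.faces) : X.facePoint f ∈ X.cell f :=
  mem_connectedComponentIn f.2.choose_spec.1

theorem cell_subset (f : X.faces) : X.cell f ⊆ X.edgeUnionᶜ := connectedComponentIn_subset _ _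

theorem closure_cell (f : X.faces) : closure (X.cell f) = f := f.2.choose_spec.2.symm

theorem cell_subset_face (f : X.faces) : X.cell f ⊆ f := by
  rw [← X.closure_cell f]; exact subset_closure

theorem isPreconnected_cell (f : X.faces) : IsPreconnected (X.cell f) :=
  isPreconnected_connectedComponentIn

theorem disjoint_cell_carrier (f : X.faces) (z : G.edgeSet →₀ ZMod 2) :
    Disjoint (X.cell f) (X.carrier z) :=
  disjoint_left.2 fun _ hx hz => X.cell_subset f hx (X.carrier_subset_edgeUnion z hz)

theorem facePoint_notMem_edgeUnion (f : X.faces) : X.facePoint f ∉ X.edgeUnion :=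
  X.cell_subset f (X.facePoint_mem_cell f)

theorem isOpen_cell [T2Space S] [LocallyCompactSpace S] [LocallyConnectedSpace S] (f : X.faces) :
    IsOpen (X.cell f) := X.isClosed_edgeUnion.isOpen_compl.connectedComponentIn

theorem disjoint_cell_face [T2Space S] [LocallyCompactSpace S] [LocallyConnectedSpace S]
    {f f' : X.faces} (hne : f ≠ f') : Disjoint (X.cell f) (f' : Set S) := by
  rw [disjoint_left]
  intro x hx hx'
  rw [← X.closure_cell f'] at hx'
  obtain ⟨y, hy, hy'⟩ := mem_closure_iff.1 hx' _ (X.isOpen_cell f) hx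
  have h : X.cell f = X.cell f' :=
    (connectedComponentIn_eq hy).trans (connectedComponentIn_eq hy').symm
  exact hne (Subtype.ext (by rw [← X.closure_cell f, ← X.closure_cell f', h]))

theorem mem_edgeUnion_of_mem_face [T2Space S] [LocallyCompactSpace S] [LocallyConnectedSpace S]
    {f : X.faces} {x : S} (hx : x ∈ (f : Set S)) (hxc : x ∉ X.cell f) : x ∈ X.edgeUnion := by
  by_contra hU
  rw [← X.closure_cell f] at hx
  obtain ⟨y, hy, hy'⟩ := mem_closure_iff.1 hx _
    (X.isClosed_edgeUnion.isOpen_compl.connectedComponentIn (x := x)) (mem_connectedComponentIn hU)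
  apply hxc
  have h : X.cell f = connectedComponentIn X.edgeUnionᶜ x :=
    (connectedComponentIn_eq hy').trans (connectedComponentIn_eq hy).symm
  rw [h]
  exact mem_connectedComponentIn hU

/-- The set of edges included in the face `f`. -/
def faceEdges (f : X.faces) : Set G.edgeSet := {e | X.arc e ⊆ f}

variable {X}

theorem IsTessellation.exists_faces (hX : X.IsTessellation) (e : G.edgeSet) :
    ∃ f f' : X.faces, f ≠ f' ∧ e ∈ X.faceEdges f ∧ e ∈ X.faceEdges f' := by
  obtain ⟨f, f', hne, h⟩ := ncard_eq_two.1 (hX.two_faces e)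
  have hf : f ∈ {f ∈ X.faces | X.arc e ⊆ f} := h ▸ mem_insert f {f'}
  have hf' : f' ∈ {f ∈ X.faces | X.arc e ⊆ f} := h ▸ mem_insert_of_mem f rfl
  exact ⟨⟨f, hf.1⟩, ⟨f', hf'.1⟩, fun h => hne (congrArg Subtype.val h), hf.2, hf'.2⟩

theorem IsTessellation.finite_faces_of_edge (hX : X.IsTessellation) (e : G.edgeSet) :
    {f : X.faces | e ∈ X.faceEdges f}.Finite := by
  have h : {f ∈ X.faces | X.arc e ⊆ f}.Finite :=
    finite_of_ncard_ne_zero (by rw [hX.two_faces e]; norm_num)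
  exact Finite.of_finite_image (f := Subtype.val) (h.subset (by
    rintro _ ⟨f, hf, rfl⟩; exact ⟨f.2, hf⟩)) Subtype.val_injective.injOn

theorem IsTessellation.isCompact_face (hX : X.IsTessellation) (f : X.faces) :
    IsCompact (f : Set S) := by
  obtain ⟨H⟩ := hX.disc f f.2
  rw [isCompact_iff_compactSpace]
  have : CompactSpace (Metric.closedBall (0 : EuclideanSpace ℝ (Fin 2)) 1) :=
    isCompact_iff_compactSpace.1 (isCompact_closedBall _ _)
  exact H.symm.compactSpace

theorem IsTessellation.finite_faceEdges (hX : X.IsTessellation) (f : X.faces) :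
    (X.faceEdges f).Finite :=
  (X.locally_compact f (hX.isCompact_face f)).subset fun e he =>
    ⟨X.curve e 0, mem_range_self 0, he (mem_range_self 0)⟩

/-- An edge that meets a face outside of the vertices is included in this face. -/
theorem IsTessellation.mem_faceEdges (hX : X.IsTessellation) {f : X.faces} {e : G.edgeSet} {x : S}
    (hxe : x ∈ X.arc e) (hxf : x ∈ (f : Set S)) (hx : ∀ v, x ≠ X.pos v) : e ∈ X.faceEdges f := by
  obtain ⟨f', -, -, hf', -⟩ := hX.exists_faces e
  by_cases h : f = f'
  · exact h ▸ hf'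
  have hmem : x ∈ (f : Set S) ∩ f' := ⟨hxf, hf' hxe⟩
  rcases hX.inter_faces f f.2 f' f'.2 (fun h' => h (Subtype.ext h')) with h1 | ⟨v, h1⟩ | ⟨e', h1⟩
  · rw [h1] at hmem; exact hmem.elim
  · rw [h1] at hmem; exact absurd hmem (hx v)
  · rw [h1] at hmem
    rw [X.eq_of_mem_arc hxe hmem hx]
    exact fun y hy => (h1.ge hy).1

/-- Mutually inverse parametrizations of a face by the closed unit disc of the complex plane. -/
theorem IsTessellation.exists_parametrization (hX : X.IsTessellation) (f : X.faces) :
    ∃ (h : ℂ → S) (k : S → ℂ), ContinuousOn h (Metric.closedBall 0 1) ∧ ContinuousOn k f ∧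
      MapsTo h (Metric.closedBall 0 1) f ∧ MapsTo k f (Metric.closedBall 0 1) ∧
      LeftInvOn k h (Metric.closedBall 0 1) ∧ LeftInvOn h k f := by
  classical
  obtain ⟨H⟩ := hX.disc f f.2
  let L : ℂ ≃ₗᵢ[ℝ] EuclideanSpace ℝ (Fin 2) := Complex.orthonormalBasisOneI.repr
  have hL : ∀ x, x ∈ Metric.closedBall (0 : ℂ) 1 →
      L x ∈ Metric.closedBall (0 : EuclideanSpace ℝ (Fin 2)) 1 := fun x hx => by
    rw [mem_closedBall_zero_iff] at hx ⊢
    rwa [L.norm_map]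
  let h : ℂ → S := fun x => if hx : x ∈ Metric.closedBall (0 : ℂ) 1 then
    (H.symm ⟨L x, hL x hx⟩ : S) else X.facePoint f
  let k : S → ℂ := fun x => if hx : x ∈ (f : Set S) then L.symm (H ⟨x, hx⟩) else 0
  have hh : ∀ x (hx : x ∈ Metric.closedBall (0 : ℂ) 1), h x = H.symm ⟨L x, hL x hx⟩ :=
    fun x hx => dif_pos hx
  have hk : ∀ x (hx : x ∈ (f : Set S)), k x = L.symm (H ⟨x, hx⟩) := fun x hx => dif_pos hx
  have hhf : MapsTo h (Metric.closedBall 0 1) f := fun x hx => by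
    rw [hh x hx]; exact Subtype.prop _
  have hkf : MapsTo k f (Metric.closedBall 0 1) := fun x hx => by
    rw [hk x hx, mem_closedBall_zero_iff, L.symm.norm_map]
    exact mem_closedBall_zero_iff.1 (Subtype.prop _)
  refine ⟨h, k, ?_, ?_, hhf, hkf, ?_, ?_⟩
  · rw [continuousOn_iff_continuous_domRestrict]
    have : (Metric.closedBall (0 : ℂ) 1).domRestrict h =
        fun x : Metric.closedBall (0 : ℂ) 1 => (H.symm ⟨L x, hL x x.2⟩ : S) :=
      funext fun x => hh x x.2
    rw [this]
    exact continuous_subtype_val.comp (H.symm.continuous.comp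
      ((L.continuous.comp continuous_subtype_val).subtype_mk _))
  · rw [continuousOn_iff_continuous_domRestrict]
    have : (f : Set S).domRestrict k = fun x => L.symm (H x) := funext fun x => hk x x.2
    rw [this]
    exact L.symm.continuous.comp (continuous_subtype_val.comp H.continuous)
  · intro x hx
    rw [hk _ (hhf hx)]
    simp [hh x hx]
  · intro x hx
    rw [hh _ (hkf hx)]
    simp [hk x hx]

theorem topology_of_homeomorph_complex (ι : S ≃ₜ ℂ) :
    T2Space S ∧ LocallyCompactSpace S ∧ LocallyConnectedSpace S ∧ ¬ CompactSpace S := by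
  refine ⟨ι.isEmbedding.t2Space, ι.isClosedEmbedding.locallyCompactSpace, ι.locallyConnectedSpace,
    fun h => ?_⟩
  have := ι.compactSpace
  exact not_compactSpace_iff.2 (inferInstance : NoncompactSpace ℂ) this

theorem IsTessellation.nonempty_edgeSet (hX : X.IsTessellation) (ι : S ≃ₜ ℂ) :
    Nonempty G.edgeSet := by
  by_contra hne
  rw [not_nonempty_iff] at hne
  have hU : X.edgeUnion = ∅ := by simp [edgeUnion]
  have hconn : ConnectedSpace S := ι.symm.surjective.connectedSpace ι.symm.continuous
  have hf : univ ∈ X.faces := by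
    refine ⟨ι.symm 0, ?_, ?_⟩
    · change _ ∈ X.edgeUnionᶜ
      simp [hU]
    · change _ = closure (connectedComponentIn X.edgeUnionᶜ _)
      rw [hU, compl_empty, connectedComponentIn_univ, PreconnectedSpace.connectedComponent_eq_univ,
        closure_univ]
  exact (topology_of_homeomorph_complex ι).2.2.2 ⟨hX.isCompact_face ⟨univ, hf⟩⟩

theorem IsTessellation.exists_edge_of_vertex (hX : X.IsTessellation) (ι : S ≃ₜ ℂ)
    (hG : G.Connected) (v : V) : ∃ e : G.edgeSet, v ∈ (e : Sym2 V) := by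
  obtain ⟨e⟩ := hX.nonempty_edgeSet ι
  have : Nontrivial V := ⟨_, _, X.src_ne_tgt e⟩
  have hv : v ∈ G.support := by
    rw [hG.preconnected.support_eq_univ]; trivial
  obtain ⟨w, hw⟩ := hv
  exact ⟨⟨s(v, w), hw⟩, by simp⟩

/-- The boundary circle of the disc is mapped outside of the open cell of the face. -/
theorem apply_sphere_notMem_cell (ι : S ≃ₜ ℂ) {f : X.faces} {h : ℂ → S} {k : S → ℂ}
    (hk : ContinuousOn k f) (hkf : MapsTo k f (Metric.closedBall 0 1))
    (hkh : LeftInvOn k h (Metric.closedBall 0 1)) (hhk : LeftInvOn h k f) {ξ : ℂ}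
    (hξ : ξ ∈ Metric.sphere (0 : ℂ) 1) : h ξ ∉ X.cell f := by
  intro hmem
  obtain ⟨_, _, _, -⟩ := topology_of_homeomorph_complex ι
  have hmaps : MapsTo ι.symm (ι '' X.cell f) f := by
    rintro _ ⟨x, hx, rfl⟩
    rw [ι.symm_apply_apply]
    exact X.cell_subset_face f hx
  have := mem_ball_of_injOn (U := ι '' X.cell f) (k := fun w => k (ι.symm w))
    (ι.isOpenMap _ (X.isOpen_cell f))
    (hk.comp ι.symm.continuous.continuousOn hmaps)
    (fun a ha b hb hab => ι.symm.injective (hhk.injOn (hmaps ha) (hmaps hb) hab))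
    (fun w hw => hkf (hmaps hw)) ⟨h ξ, hmem, rfl⟩
  simp only [ι.symm_apply_apply] at this
  rw [hkh (Metric.sphere_subset_closedBall hξ)] at this
  rw [mem_sphere_zero_iff_norm] at hξ
  rw [mem_ball_zero_iff, hξ] at this
  exact lt_irrefl _ this

/-- The boundary circle of the disc is mapped to the union of the edges included in the face. -/
theorem IsTessellation.apply_mem_arc (hX : X.IsTessellation) (ι : S ≃ₜ ℂ) {f : X.faces}
    {h : ℂ → S} {k : S → ℂ} (hh : ContinuousOn h (Metric.closedBall 0 1)) (hk : ContinuousOn k f)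
    (hhf : MapsTo h (Metric.closedBall 0 1) f)
    (hkf : MapsTo k f (Metric.closedBall 0 1)) (hkh : LeftInvOn k h (Metric.closedBall 0 1))
    (hhk : LeftInvOn h k f) {ξ : ℂ} (hξ : ξ ∈ Metric.sphere (0 : ℂ) 1) :
    h ξ ∈ ⋃ e ∈ X.faceEdges f, X.arc e := by
  obtain ⟨_, _, _, -⟩ := topology_of_homeomorph_complex ι
  have hsub : Metric.sphere (0 : ℂ) 1 ⊆ Metric.closedBall 0 1 := Metric.sphere_subset_closedBall
  have hedge : ∀ η ∈ Metric.sphere (0 : ℂ) 1, ∃ e, h η ∈ X.arc e := fun η hη =>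
    mem_iUnion.1 (X.mem_edgeUnion_of_mem_face (hhf (hsub hη))
      (apply_sphere_notMem_cell ι hk hkf hkh hhk hη))
  set Z := ⋃ e ∈ X.faceEdges f, X.arc e with hZ
  have hZc : IsClosed Z :=
    (hX.finite_faceEdges f).isClosed_biUnion fun e _ => (X.isCompact_arc e).isClosed
  -- only finitely many points of the circle are mapped to vertices
  set B := {η ∈ Metric.sphere (0 : ℂ) 1 | ∃ v, h η = X.pos v} with hB
  have hBfin : B.Finite := by
    have h1 := X.locally_compact f (hX.isCompact_face f)
    have h2 : (⋃ e ∈ {e | (range (X.curve e) ∩ (f : Set S)).Nonempty},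
        ({X.pos (X.src e), X.pos (X.tgt e)} : Set S)).Finite :=
      h1.biUnion fun e _ => by simp
    refine Finite.of_finite_image (f := h) (h2.subset ?_) (hkh.injOn.mono fun η hη => hsub hη.1)
    rintro _ ⟨η, ⟨hη, v, hv⟩, rfl⟩
    obtain ⟨e, he⟩ := hedge η hη
    refine mem_biUnion (x := e) ⟨h η, he, hhf (hsub hη)⟩ ?_
    rw [hv] at he ⊢
    rcases (X.mem_edge_iff e v).1 ((X.pos_mem_arc_iff e v).1 he) with rfl | rfl <;> simp
  have hgood : ∀ η ∈ Metric.sphere (0 : ℂ) 1 \ B, h η ∈ Z := by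
    rintro η ⟨hη, hηB⟩
    obtain ⟨e, he⟩ := hedge η hη
    exact mem_biUnion (hX.mem_faceEdges he (hhf (hsub hη)) fun v hv => hηB ⟨hη, v, hv⟩) he
  have hcl : ξ ∈ closure (Metric.sphere (0 : ℂ) 1 \ B) := by
    have hrank : 1 < Module.rank ℝ ℂ := by rw [Complex.rank_real_complex]; norm_num
    have hnt : (Metric.sphere (0 : ℂ) 1).Nontrivial :=
      ⟨1, by simp, -1, by simp, by norm_num⟩
    have hacc := (isPreconnected_sphere hrank (0 : ℂ) 1).preperfect_of_nontrivial hnt ξ hξ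
    rw [mem_closure_iff_nhds]
    intro t ht
    have ht' : t ∩ (B \ {ξ})ᶜ ∈ 𝓝 ξ :=
      inter_mem ht ((hBfin.subset sdiff_subset).isClosed.isOpen_compl.mem_nhds (by simp))
    obtain ⟨η, ⟨⟨hηt, hηB⟩, hηs⟩, hne⟩ := accPt_iff_nhds.1 hacc _ ht'
    exact ⟨η, hηt, hηs, fun h => hηB ⟨h, hne⟩⟩
  have := (((hh.mono hsub) ξ hξ).mono sdiff_subset).mem_closure hcl hgood
  rwa [hZc.closure_eq] at this

end SurfaceEmbedding

namespace SurfaceEmbedding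

variable {V : Type*} {G : SimpleGraph V} {S : Type*} [TopologicalSpace S]
  (X : SurfaceEmbedding G S)

/-! ### The boundary cycle of a face -/

/-- Continuous functions on finitely many edges that agree at the vertices can be glued. -/
theorem exists_glue [T2Space S] {E₀ : Set G.edgeSet} (hE : E₀.Finite)
    {s : G.edgeSet → unitInterval → ℂ} {r : V → ℂ} (hs : ∀ e ∈ E₀, Continuous (s e))
    (h0 : ∀ e ∈ E₀, s e 0 = r (X.src e)) (h1 : ∀ e ∈ E₀, s e 1 = r (X.tgt e)) :
    ∃ σ : S → ℂ, ContinuousOn σ (⋃ e ∈ E₀, X.arc e) ∧ ∀ e ∈ E₀, ∀ t, σ (X.curve e t) = s e t := by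
  classical
  have hcons : ∀ e ∈ E₀, ∀ e' ∈ E₀, ∀ t t', X.curve e t = X.curve e' t' → s e t = s e' t' := by
    intro e he e' he' t t' htt
    by_cases hee : e = e'
    · subst hee
      rw [X.curve_injective e htt]
    obtain ⟨v, hv, hv', hpos⟩ := X.curves_meet e e' t t' hee htt
    have hval : ∀ e ∈ E₀, v ∈ (e : Sym2 V) → ∀ t, X.curve e t = X.pos v → s e t = r v := by
      intro e he hv t ht
      rcases X.curve_eq_pos hv ht with ⟨rfl, rfl⟩ | ⟨rfl, rfl⟩
      · exact h0 e he
      · exact h1 e he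
    rw [hval e he hv t hpos, hval e' he' hv' t' (htt ▸ hpos)]
  let σ : S → ℂ := fun x => if h : ∃ p : G.edgeSet × unitInterval, p.1 ∈ E₀ ∧ X.curve p.1 p.2 = x
    then s h.choose.1 h.choose.2 else 0
  have hσ : ∀ e ∈ E₀, ∀ t, σ (X.curve e t) = s e t := by
    intro e he t
    have h : ∃ p : G.edgeSet × unitInterval, p.1 ∈ E₀ ∧ X.curve p.1 p.2 = X.curve e t :=
      ⟨(e, t), he, rfl⟩
    rw [show σ (X.curve e t) = s h.choose.1 h.choose.2 from dif_pos h]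
    exact hcons _ h.choose_spec.1 _ he _ _ h.choose_spec.2
  refine ⟨σ, ?_, hσ⟩
  have : Finite E₀ := hE
  rw [biUnion_eq_iUnion]
  refine (locallyFinite_of_finite _).continuousOn_iUnion
    (fun e => (X.isCompact_arc e).isClosed) fun e => ?_
  have hind : IsInducing (X.curve e) :=
    ((X.curve_continuous e).isClosedEmbedding (X.curve_injective e)).isInducing
  rw [arc, ← image_univ, hind.continuousOn_image_iff, continuousOn_univ]
  exact (hs e e.2).congr fun t => (hσ e e.2 t).symm

open Classical in
theorem bdry_apply (z : G.edgeSet →₀ ZMod 2) (v : V) :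
    X.bdry z v = ∑ e ∈ z.support, if v ∈ (e : Sym2 V) then z e else 0 := by
  classical
  rw [bdry, Finsupp.linearCombination_apply, Finsupp.sum, Finsupp.finsetSum_apply]
  refine Finset.sum_congr rfl fun e _ => ?_
  have hne := X.src_ne_tgt e
  simp only [Finsupp.smul_apply, Finsupp.add_apply, Finsupp.single_apply, smul_eq_mul,
    X.mem_edge_iff]
  by_cases h1 : X.src e = v
  · have h2 : X.tgt e ≠ v := fun h => hne (h1.trans h.symm)
    simp [h1, h2]
  · by_cases h2 : X.tgt e = v
    · simp [h1, h2]
    · simp [h1, h2, Ne.symm h1, Ne.symm h2]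

theorem bdry_apply_eq_zero {z : G.edgeSet →₀ ZMod 2} {v : V}
    (h : ∀ e ∈ z.support, v ∉ (e : Sym2 V)) : X.bdry z v = 0 := by
  rw [X.bdry_apply]
  exact Finset.sum_eq_zero fun e he => if_neg (h e he)

/-- Each vertex on a cycle lies on at least two edges of the cycle. -/
theorem exists_ne_edge_of_bdry {z : G.edgeSet →₀ ZMod 2} (hz : X.bdry z = 0) {e : G.edgeSet}
    (he : e ∈ z.support) {v : V} (hv : v ∈ (e : Sym2 V)) :
    ∃ e' ∈ z.support, e' ≠ e ∧ v ∈ (e' : Sym2 V) := by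
  by_contra! h
  have h1 := X.bdry_apply z v
  rw [hz, Finset.sum_eq_single e (fun e' he' hne => if_neg (h e' he' hne))
    (fun h => absurd he h), if_pos hv] at h1
  exact Finsupp.mem_support_iff.1 he h1.symm

/-- The coefficients of a boundary add up to zero. -/
theorem sum_bdry (z : G.edgeSet →₀ ZMod 2) :
    Finsupp.linearCombination (ZMod 2) (fun _ : V => (1 : ZMod 2)) (X.bdry z) = 0 := by
  rw [← X.linearCombination_bdry]
  simp [zmod_two_add_self, Finsupp.linearCombination_apply]

/-- A cycle that does not contain the edge `e` winds equally often around the faces that contain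
`e`. -/
theorem wind_facePoint_eq (ι : S ≃ₜ ℂ) {z : G.edgeSet →₀ ZMod 2} (hz : X.bdry z = 0)
    {e : G.edgeSet} (he : z e = 0) {f f' : X.faces} (hf : e ∈ X.faceEdges f)
    (hf' : e ∈ X.faceEdges f') :
    X.wind ι (X.facePoint f) z = X.wind ι (X.facePoint f') z := by
  have h : ∀ f : X.faces, e ∈ X.faceEdges f →
      X.wind ι (X.facePoint f) z = X.wind ι (X.midpoint e) z := fun f hf =>
    X.wind_eq_of_mem_closure ι hz (X.isPreconnected_cell f) (X.disjoint_cell_carrier f z)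
      (X.facePoint_mem_cell f) (by rw [X.closure_cell]; exact hf (X.midpoint_mem_arc e))
      (X.midpoint_notMem_carrier he)
  rw [h f hf, h f' hf']

theorem wind_facePoint_eq_of_mem_face (ι : S ≃ₜ ℂ) {z : G.edgeSet →₀ ZMod 2} (hz : X.bdry z = 0)
    {f : X.faces} {x : S} (hx : x ∈ (f : Set S)) (hxz : x ∉ X.carrier z) :
    X.wind ι (X.facePoint f) z = X.wind ι x z :=
  X.wind_eq_of_mem_closure ι hz (X.isPreconnected_cell f) (X.disjoint_cell_carrier f z)
    (X.facePoint_mem_cell f) (by rwa [X.closure_cell]) hxz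

variable {X}

theorem carrier_subset_face {f : X.faces} {z : G.edgeSet →₀ ZMod 2}
    (hz : ↑z.support ⊆ X.faceEdges f) : X.carrier z ⊆ f := iUnion₂_subset fun _ he => hz he

/-- A cycle in a face does not wind around points outside of this face, since the face is
contractible. -/
theorem IsTessellation.wind_eq_zero (hX : X.IsTessellation) (ι : S ≃ₜ ℂ) {f : X.faces}
    {z : G.edgeSet →₀ ZMod 2} (hz : X.bdry z = 0) (hzf : ↑z.support ⊆ X.faceEdges f) {p : S}
    (hp : p ∉ (f : Set S)) : X.wind ι p z = 0 := by
  obtain ⟨h, k, hh, hk, hhf, hkf, hkh, hhk⟩ := hX.exists_parametrization f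
  have hsub := carrier_subset_face hzf
  have hι := ι.continuous
  have hne : ∀ x ∈ (f : Set S), ι x - ι p ≠ 0 := fun x hx h0 =>
    hp (ι.injective (sub_eq_zero.1 h0) ▸ hx)
  refine X.windParity_eq_zero hz (by fun_prop) (fun x hx => hne x (hsub hx)) ?_
  obtain ⟨s, hs, hs2⟩ := hasSqrtOn_of_starConvex (isCompact_closedBall (0 : ℂ) 1)
    ((convex_closedBall (0 : ℂ) 1).starConvex (by simp)) (g := fun w => ι (h w) - ι p)
    ((ι.continuous.comp_continuousOn hh).sub continuousOn_const) fun w hw => hne _ (hhf hw)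
  refine ⟨fun x => s (k x), (hs.comp hk hkf).mono hsub, fun x hx => ?_⟩
  simp only [hs2 _ (hkf (hsub hx)), hhk (hsub hx)]

/-- Some cycle in a face winds around the interior of the face: otherwise the square roots along the
edges fit together to a continuous square root on the boundary circle. -/
theorem IsTessellation.exists_wind_ne_zero (hX : X.IsTessellation) (ι : S ≃ₜ ℂ) (f : X.faces) :
    ∃ z : G.edgeSet →₀ ZMod 2, ↑z.support ⊆ X.faceEdges f ∧ X.bdry z = 0 ∧
      X.wind ι (X.facePoint f) z ≠ 0 := by
  by_contra! hno
  obtain ⟨_, -, -, -⟩ := topology_of_homeomorph_complex ι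
  obtain ⟨c, hc⟩ := X.exists_potential (X.faceEdges f) hno
  set p := X.facePoint f
  set g : S → ℂ := fun x => ι x - ι p with hg
  have hgc : Continuous g := ι.continuous.sub continuous_const
  have hne : ∀ e, ∀ x ∈ X.arc e, g x ≠ 0 := by
    intro e x hx h0
    have hxp : x = p := ι.injective (sub_eq_zero.1 h0)
    rw [hxp] at hx
    exact X.facePoint_notMem_edgeUnion f (X.arc_subset_edgeUnion e hx)
  choose s hs hs2 hs0 hs1 using fun e => X.edgeParity_spec (e := e) hgc.continuousOn (hne e)
  obtain ⟨σ, hσ, hσs⟩ := X.exists_glue (hX.finite_faceEdges f)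
    (s := fun e t => sgn (c (X.src e)) * s e t) (r := fun v => sgn (c v) * root (g (X.pos v)))
    (fun e _ => continuous_const.mul (hs e)) (fun e _ => by rw [hs0])
    (fun e he => by
      rw [hs1, ← mul_assoc, ← sgn_add, hc e he, ← add_assoc, zmod_two_add_self, zero_add])
  obtain ⟨h, k, hh, hk, hhf, hkf, hkh, hhk⟩ := hX.exists_parametrization f
  have hsub : Metric.sphere (0 : ℂ) 1 ⊆ Metric.closedBall 0 1 := Metric.sphere_subset_closedBall
  have hpf : p ∈ (f : Set S) := X.cell_subset_face f (X.facePoint_mem_cell f)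
  have hy : k p ∈ Metric.ball (0 : ℂ) 1 := by
    have h1 := hkf hpf
    rw [← Metric.ball_union_sphere] at h1
    refine h1.resolve_right fun h2 => ?_
    apply apply_sphere_notMem_cell ι hk hkf hkh hhk h2
    rw [hhk hpf]
    exact X.facePoint_mem_cell f
  have hmem : MapsTo h (Metric.sphere 0 1) (⋃ e ∈ X.faceEdges f, X.arc e) := fun ξ hξ =>
    hX.apply_mem_arc ι hh hk hhf hkf hkh hhk hξ
  have hrank : 1 < Module.rank ℝ ℂ := by rw [Complex.rank_real_complex]; norm_num
  refine not_hasSqrtOn_sphere hrank (h := fun w => ι (h w)) (ι.continuous.comp_continuousOn hh)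
    (fun a ha b hb hab => hkh.injOn ha hb (ι.injective hab)) hy
    ⟨fun w => σ (h w), hσ.comp (hh.mono hsub) hmem, fun w hw => ?_⟩
  obtain ⟨e, he, t, ht⟩ := mem_iUnion₂.1 (hmem hw)
  simp only [hhk hpf, ← ht]
  rw [hσs e he, mul_pow, sq (sgn _), sgn_mul_self, one_mul, hs2]

/-- A cycle in a face that winds around the interior of the face contains all edges of the face:
across a missing edge one could leave the face without changing the winding parity. -/
theorem IsTessellation.apply_ne_zero (hX : X.IsTessellation) (ι : S ≃ₜ ℂ) {f : X.faces}
    {z : G.edgeSet →₀ ZMod 2} (hzf : ↑z.support ⊆ X.faceEdges f) (hz : X.bdry z = 0)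
    (hw : X.wind ι (X.facePoint f) z ≠ 0) {e : G.edgeSet} (he : e ∈ X.faceEdges f) : z e ≠ 0 := by
  intro h0
  obtain ⟨_, _, _, -⟩ := topology_of_homeomorph_complex ι
  obtain ⟨f', hne, hf'⟩ : ∃ f', f' ≠ f ∧ e ∈ X.faceEdges f' := by
    obtain ⟨f₁, f₂, hne, h₁, h₂⟩ := hX.exists_faces e
    by_cases h : f₁ = f
    · exact ⟨f₂, fun h' => hne (h.trans h'.symm), h₂⟩
    · exact ⟨f₁, h, h₁⟩
  apply hw
  rw [X.wind_facePoint_eq ι hz h0 he hf']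
  exact hX.wind_eq_zero ι hz hzf
    (disjoint_left.1 (X.disjoint_cell_face hne) (X.facePoint_mem_cell f'))

/-- The edges of a face form a cycle, which winds around the interior of this face and around no
other face. -/
theorem IsTessellation.exists_faceCycle (hX : X.IsTessellation) (ι : S ≃ₜ ℂ) (f : X.faces) :
    ∃ z : G.edgeSet →₀ ZMod 2, ↑z.support = X.faceEdges f ∧ X.bdry z = 0 ∧
      X.wind ι (X.facePoint f) z = 1 ∧ ∀ f' ≠ f, X.wind ι (X.facePoint f') z = 0 := by
  obtain ⟨_, _, _, -⟩ := topology_of_homeomorph_complex ι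
  obtain ⟨z, hzf, hz, hw⟩ := hX.exists_wind_ne_zero ι f
  refine ⟨z, hzf.antisymm fun e he => ?_, hz, (zmod_two_eq _).resolve_left hw, fun f' hne => ?_⟩
  · exact Finsupp.mem_support_iff.2 (hX.apply_ne_zero ι hzf hz hw he)
  · exact hX.wind_eq_zero ι hz hzf
      (disjoint_left.1 (X.disjoint_cell_face hne) (X.facePoint_mem_cell f'))

theorem apply_eq_one_of_mem_support {z : G.edgeSet →₀ ZMod 2} {e : G.edgeSet}
    (he : e ∈ z.support) : z e = 1 :=
  (zmod_two_eq _).resolve_left (Finsupp.mem_support_iff.1 he)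

/-- A cycle in a face that misses an edge of the face is zero. -/
theorem IsTessellation.eq_zero_of_apply_eq_zero (hX : X.IsTessellation) (ι : S ≃ₜ ℂ) {f : X.faces}
    {z : G.edgeSet →₀ ZMod 2} (hzf : ↑z.support ⊆ X.faceEdges f) (hz : X.bdry z = 0)
    {e : G.edgeSet} (he : e ∈ X.faceEdges f) (h0 : z e = 0) : z = 0 := by
  classical
  obtain ⟨c, hcf, hc, hw, -⟩ := hX.exists_faceCycle ι f
  have hw0 : X.wind ι (X.facePoint f) z = 0 := by
    by_contra hne
    exact hX.apply_ne_zero ι hzf hz hne he h0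
  have hsum : ∀ e' ∈ X.faceEdges f, (z + c) e' ≠ 0 := fun e' he' =>
    hX.apply_ne_zero ι (z := z + c) (fun e'' h => by
      rcases Finset.mem_union.1 (Finsupp.support_add h) with h | h
      · exact hzf h
      · exact hcf.le h) (by rw [map_add, hz, hc, add_zero])
      (by rw [map_add, hw0, hw, zero_add]; exact one_ne_zero) he'
  ext e'
  by_cases he' : e' ∈ X.faceEdges f
  · refine (zmod_two_eq (z e')).resolve_right fun h1 => hsum e' he' ?_
    rw [Finsupp.add_apply, h1, apply_eq_one_of_mem_support (hcf.ge he'), zmod_two_add_self]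
  · exact Finsupp.notMem_support_iff.1 fun h => he' (hzf h)

/-- A cycle that winds around no face is zero. -/
theorem IsTessellation.eq_zero_of_wind_eq_zero (hX : X.IsTessellation) (ι : S ≃ₜ ℂ)
    {z : G.edgeSet →₀ ZMod 2} (hz : X.bdry z = 0)
    (hw : ∀ f, X.wind ι (X.facePoint f) z = 0) : z = 0 := by
  ext e
  refine (zmod_two_eq (z e)).resolve_right fun h1 => ?_
  obtain ⟨f, f', hne, hf, hf'⟩ := hX.exists_faces e
  -- adding the boundary of `f` removes the edge `e` and changes the winding parity around `f` only
  obtain ⟨c, hcf, hc, hwc, hwc'⟩ := hX.exists_faceCycle ι f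
  have h2 := X.wind_facePoint_eq ι (z := z + c) (by rw [map_add, hz, hc, add_zero]) (e := e)
    (by rw [Finsupp.add_apply, h1, apply_eq_one_of_mem_support (hcf.ge hf), zmod_two_add_self])
    hf hf'
  rw [map_add, map_add, hw, hw, hwc, hwc' f' hne.symm] at h2
  simp at h2

/-- A vertex in a face lies on an edge included in this face. -/
theorem IsTessellation.exists_faceEdge_of_vertex (hX : X.IsTessellation) (ι : S ≃ₜ ℂ)
    (hG : G.Connected) {f : X.faces} {v : V} (hv : X.pos v ∈ (f : Set S)) :
    ∃ e ∈ X.faceEdges f, v ∈ (e : Sym2 V) := by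
  by_contra! hno
  obtain ⟨c, hcf, hc, hwc, hwc'⟩ := hX.exists_faceCycle ι f
  have hvc : X.pos v ∉ X.carrier c := by
    intro h
    obtain ⟨e, he, hve⟩ := mem_iUnion₂.1 h
    exact hno e (hcf.le he) ((X.pos_mem_arc_iff e v).1 hve)
  obtain ⟨e, he⟩ := hX.exists_edge_of_vertex ι hG v
  obtain ⟨f', hne, hf'⟩ : ∃ f', f' ≠ f ∧ e ∈ X.faceEdges f' := by
    obtain ⟨f₁, f₂, hne, h₁, h₂⟩ := hX.exists_faces e
    by_cases h : f₁ = f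
    · exact ⟨f₂, fun h' => hne (h.trans h'.symm), h₂⟩
    · exact ⟨f₁, h, h₁⟩
  have h1 := X.wind_facePoint_eq_of_mem_face ι hc hv hvc
  have h2 := X.wind_facePoint_eq_of_mem_face ι hc (hf' (X.pos_mem_arc e v he)) hvc
  rw [hwc] at h1
  rw [hwc' f' hne, ← h1] at h2
  exact zero_ne_one h2

theorem IsTessellation.nonempty_faceEdges (hX : X.IsTessellation) (ι : S ≃ₜ ℂ) (f : X.faces) :
    (X.faceEdges f).Nonempty := by
  obtain ⟨c, hcf, -, hw, -⟩ := hX.exists_faceCycle ι f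
  rw [← hcf, Finset.coe_nonempty, Finsupp.support_nonempty_iff]
  rintro rfl
  simp at hw

/-- A vertex in a face lies on two edges included in this face. -/
theorem IsTessellation.exists_ne_faceEdge (hX : X.IsTessellation) (ι : S ≃ₜ ℂ) {f : X.faces}
    {e : G.edgeSet} (he : e ∈ X.faceEdges f) {v : V} (hv : v ∈ (e : Sym2 V)) :
    ∃ e' ∈ X.faceEdges f, e' ≠ e ∧ v ∈ (e' : Sym2 V) := by
  obtain ⟨c, hcf, hc, -⟩ := hX.exists_faceCycle ι f
  obtain ⟨e', he', h⟩ := X.exists_ne_edge_of_bdry hc (hcf.ge he) hv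
  exact ⟨e', hcf.le he', h⟩

theorem IsTessellation.three_le_faceDegree (hX : X.IsTessellation) (ι : S ≃ₜ ℂ) (f : X.faces) :
    3 ≤ X.faceDegree f := by
  obtain ⟨e, he⟩ := hX.nonempty_faceEdges ι f
  obtain ⟨e₁, he₁, hne₁, hv₁⟩ := hX.exists_ne_faceEdge ι he (X.src_mem e)
  obtain ⟨e₂, he₂, hne₂, hv₂⟩ := hX.exists_ne_faceEdge ι he (X.tgt_mem e)
  have hne : e₁ ≠ e₂ := by
    rintro rfl
    exact hne₁ (Subtype.ext (((Sym2.mem_and_mem_iff (X.src_ne_tgt e)).1 ⟨hv₁, hv₂⟩).trans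
      (X.edge_eq e).symm))
  have hsub : ({e, e₁, e₂} : Set G.edgeSet) ⊆ X.faceEdges f := by
    rintro _ (rfl | rfl | rfl) <;> assumption
  have h3 : ({e, e₁, e₂} : Set G.edgeSet).ncard = 3 :=
    ncard_eq_three.2 ⟨e, e₁, e₂, hne₁.symm, hne₂.symm, hne, rfl⟩
  rw [← h3]
  exact ncard_le_ncard hsub (hX.finite_faceEdges f)

theorem IsTessellation.finite_faces_of_vertex (hX : X.IsTessellation) (ι : S ≃ₜ ℂ)
    (hG : G.Connected) (v : V) : {f : X.faces | X.pos v ∈ (f : Set S)}.Finite := by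
  have hfin : {e : G.edgeSet | v ∈ (e : Sym2 V)}.Finite :=
    (X.locally_compact {X.pos v} isCompact_singleton).subset fun e he =>
      ⟨X.pos v, X.pos_mem_arc e v he, rfl⟩
  refine (hfin.biUnion fun e _ => hX.finite_faces_of_edge e).subset fun f hf => ?_
  obtain ⟨e, he, hve⟩ := hX.exists_faceEdge_of_vertex ι hG hf
  exact mem_biUnion (x := e) hve he

/-- The graph is infinite, since the plane is not a finite union of discs. -/
theorem IsTessellation.infinite (hX : X.IsTessellation) (ι : S ≃ₜ ℂ) : Infinite V := by
  by_contra hfin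
  rw [not_infinite_iff_finite] at hfin
  have hfaces : Finite X.faces := by
    have h : (⋃ e : G.edgeSet, {f : X.faces | e ∈ X.faceEdges f}).Finite :=
      finite_iUnion fun e => hX.finite_faces_of_edge e
    refine finite_univ_iff.1 (h.subset fun f _ => ?_)
    obtain ⟨e, he⟩ := hX.nonempty_faceEdges ι f
    exact mem_iUnion.2 ⟨e, he⟩
  refine (topology_of_homeomorph_complex ι).2.2.2 ⟨?_⟩
  have hcover : (univ : Set S) = ⋃ f : X.faces, (f : Set S) := by
    refine (eq_univ_of_forall fun x => ?_).symm
    by_cases hx : x ∈ X.edgeUnion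
    · obtain ⟨e, he⟩ := mem_iUnion.1 hx
      obtain ⟨f, -, -, hf, -⟩ := hX.exists_faces e
      exact mem_iUnion.2 ⟨f, hf he⟩
    · refine mem_iUnion.2 ⟨⟨closure (connectedComponentIn X.edgeUnionᶜ x), x, hx, rfl⟩, ?_⟩
      exact subset_closure (mem_connectedComponentIn hx)
  rw [hcover]
  exact isCompact_iUnion fun f => hX.isCompact_face f

end SurfaceEmbedding

/-! ### Counting vertices, edges and faces -/

/-- If the chains on `E₀` are separated by a family of functionals indexed by `B`, then `E₀` has at
most as many elements as `B`. -/
theorem card_le_card_of_dual {K E B : Type*} [Field K] [Fintype B] (E₀ : Finset E)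
    (φ : B → (E →₀ K) →ₗ[K] K)
    (h : ∀ z : E →₀ K, ↑z.support ⊆ (E₀ : Set E) → (∀ b, φ b z = 0) → z = 0) :
    E₀.card ≤ Fintype.card B := by
  let J : (E₀ →₀ K) →ₗ[K] (E →₀ K) := Finsupp.lmapDomain K K Subtype.val
  have hJ : Function.Injective J := Finsupp.mapDomain_injective Subtype.val_injective
  let L : (E₀ →₀ K) →ₗ[K] (B → K) := LinearMap.pi fun b => φ b ∘ₗ J
  have hL : Function.Injective L := by
    rw [injective_iff_map_eq_zero]
    intro z hz
    refine (map_eq_zero_iff J hJ).1 (h _ ?_ fun b => congrFun hz b)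
    classical
    intro e he
    obtain ⟨e', -, rfl⟩ := Finset.mem_image.1 (Finsupp.mapDomain_support he)
    exact e'.2
  simpa using LinearMap.finrank_le_finrank_of_injective hL

/-- The pairs of adjacent vertices the first of which belongs to `W` and the second does not. -/
def edgeBoundary {V : Type*} (G : SimpleGraph V) [G.LocallyFinite] (W : Finset V) :
    Finset (Σ _ : V, V) :=
  open Classical in W.sigma fun v => (G.neighborFinset v).filter (· ∉ W)

theorem mem_edgeBoundary {V : Type*} {G : SimpleGraph V} [G.LocallyFinite] {W : Finset V}
    {p : Σ _ : V, V} : p ∈ edgeBoundary G W ↔ p.1 ∈ W ∧ G.Adj p.1 p.2 ∧ p.2 ∉ W := by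
  simp [edgeBoundary]

namespace SurfaceEmbedding

variable {V : Type*} {G : SimpleGraph V} {S : Type*} [TopologicalSpace S]
  {X : SurfaceEmbedding G S}

/-- A face has at least as many vertices as edges, because the cycles in a face are determined by
any one of their coefficients. -/
theorem IsTessellation.faceDegree_le (hX : X.IsTessellation) (ι : S ≃ₜ ℂ) {f : X.faces}
    {A : Finset V} (hA : ∀ v, v ∈ A ↔ X.pos v ∈ (f : Set S)) : X.faceDegree f ≤ A.card := by
  classical
  obtain ⟨e₀, he₀⟩ := hX.nonempty_faceEdges ι f
  have hv₀ : X.src e₀ ∈ A := (hA _).2 (he₀ (X.pos_mem_arc e₀ _ (X.src_mem e₀)))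
  have hcard : X.faceDegree f = (hX.finite_faceEdges f).toFinset.card :=
    ncard_eq_toFinset_card _ _
  rw [hcard, ← Fintype.card_coe A]
  -- the coefficients of the boundary at the vertices of `f`, where the one at `src e₀`, which is
  -- determined by the others, is combined with the coefficient of `e₀`
  refine card_le_card_of_dual (K := ZMod 2) _
    (fun v : A => Finsupp.lapply v.1 ∘ₗ X.bdry +
      if v.1 = X.src e₀ then Finsupp.lapply e₀ else 0) fun z hzf hz => ?_
  rw [Finite.coe_toFinset] at hzf
  have hne : ∀ v, v ≠ X.src e₀ → X.bdry z v = 0 := by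
    intro v hv
    by_cases hvA : v ∈ A
    · simpa [hv] using hz ⟨v, hvA⟩
    · exact X.bdry_apply_eq_zero fun e he hve => hvA ((hA v).2 (hzf he (X.pos_mem_arc e v hve)))
  have hsingle : X.bdry z = Finsupp.single (X.src e₀) (X.bdry z (X.src e₀)) := by
    ext v
    by_cases hv : v = X.src e₀
    · rw [hv, Finsupp.single_eq_same]
    · rw [hne v hv, Finsupp.single_eq_of_ne hv]
  have h0 : X.bdry z (X.src e₀) = 0 := by
    have h1 := X.sum_bdry z
    rw [hsingle] at h1
    simpa using h1
  refine hX.eq_zero_of_apply_eq_zero ι hzf ?_ he₀ ?_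
  · rw [hsingle, h0, Finsupp.single_zero]
  · simpa [h0] using hz ⟨X.src e₀, hv₀⟩

theorem IsTessellation.finite_faces_of_subset (hX : X.IsTessellation) (ι : S ≃ₜ ℂ)
    (hG : G.Connected) (W : Finset V) :
    {f : X.faces | ∀ v, X.pos v ∈ (f : Set S) → v ∈ W}.Finite := by
  refine (W.finite_toSet.biUnion fun v _ => hX.finite_faces_of_vertex ι hG v).subset fun f hf => ?_
  obtain ⟨e, he⟩ := hX.nonempty_faceEdges ι f
  have h := he (X.pos_mem_arc e _ (X.src_mem e))
  exact mem_biUnion (x := X.src e) (hf _ h) h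

theorem finite_edges_of_subset (X : SurfaceEmbedding G S) (W : Finset V) :
    {e : G.edgeSet | ∀ v ∈ (e : Sym2 V), v ∈ W}.Finite := by
  refine (X.locally_compact (X.pos '' W) (W.finite_toSet.image _).isCompact).subset fun e he => ?_
  exact ⟨X.pos (X.src e), X.pos_mem_arc e _ (X.src_mem e), _, he _ (X.src_mem e), rfl⟩

theorem pos_notMem_carrier {W : Finset V} {z : G.edgeSet →₀ ZMod 2}
    (hz : ∀ e ∈ z.support, ∀ v ∈ (e : Sym2 V), v ∈ W) {v : V} (hv : v ∉ W) :
    X.pos v ∉ X.carrier z := by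
  intro h
  obtain ⟨e, he, hve⟩ := mem_iUnion₂.1 h
  exact hv (hz e he v ((X.pos_mem_arc_iff e v).1 hve))

theorem wind_pos_eq_of_adj (ι : S ≃ₜ ℂ) {W : Finset V} {z : G.edgeSet →₀ ZMod 2}
    (hb : X.bdry z = 0) (hz : ∀ e ∈ z.support, ∀ v ∈ (e : Sym2 V), v ∈ W) {v w : V}
    (hv : v ∉ W) (hw : w ∉ W) (hvw : G.Adj v w) :
    X.wind ι (X.pos v) z = X.wind ι (X.pos w) z := by
  let e : G.edgeSet := ⟨s(v, w), hvw⟩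
  have hmem : ∀ u ∈ (e : Sym2 V), u ∉ W := fun u hu => by
    rcases Sym2.mem_iff.1 hu with rfl | rfl <;> assumption
  refine X.wind_eq_of_isPreconnected ι hb (isPreconnected_range (X.curve_continuous e)) ?_
    (X.pos_mem_arc e v (by simp [e])) (X.pos_mem_arc e w (by simp [e]))
  rw [disjoint_left]
  rintro _ ⟨t, rfl⟩ h
  obtain ⟨e', he', t', ht'⟩ := mem_iUnion₂.1 h
  by_cases hee : e = e'
  · exact hv (hz e' he' v (hee ▸ by simp [e]))
  · obtain ⟨u, hu, hu', -⟩ := X.curves_meet e e' t t' hee ht'.symm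
    exact hmem u hu (hz e' he' u hu')

/-- The faces at the vertex `v`. -/
def IsTessellation.facesAt (hX : X.IsTessellation) (ι : S ≃ₜ ℂ) (hG : G.Connected) (v : V) :
    Finset X.faces := (hX.finite_faces_of_vertex ι hG v).toFinset

theorem IsTessellation.mem_facesAt (hX : X.IsTessellation) (ι : S ≃ₜ ℂ) (hG : G.Connected) {v : V}
    {f : X.faces} : f ∈ hX.facesAt ι hG v ↔ X.pos v ∈ (f : Set S) := by
  simp [facesAt]

variable [G.LocallyFinite]

/-- The Euler type inequality `0 ≤ #W - #E_W + #F_W + #∂W`, where `E_W` and `F_W` are the sets of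
the edges and the faces all of whose vertices belong to `W`. A cycle with vertices in `W` is
determined by its winding parities around the faces in `F_W` and around the vertices outside of
`W`, and the latter are equal for any two vertices that are connected outside of `W`. -/
theorem IsTessellation.card_edges_le (hX : X.IsTessellation) (ι : S ≃ₜ ℂ) (hG : G.Connected)
    {W : Finset V} (hW : W.Nonempty) :
    (X.finite_edges_of_subset W).toFinset.card ≤
      W.card + ((hX.finite_faces_of_subset ι hG W).toFinset.card + (edgeBoundary G W).card) := by
  classical
  set FW := (hX.finite_faces_of_subset ι hG W).toFinset with hFW
  rw [← Fintype.card_coe W, ← Fintype.card_coe FW, ← Fintype.card_coe (edgeBoundary G W),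
    ← Fintype.card_sum, ← Fintype.card_sum]
  refine card_le_card_of_dual (K := ZMod 2) _ (Sum.elim (fun v : W => Finsupp.lapply v.1 ∘ₗ X.bdry)
    (Sum.elim (fun f : FW => X.wind ι (X.facePoint f.1))
      fun p : edgeBoundary G W => X.wind ι (X.pos p.1.2))) fun z hzW hz => ?_
  have hzE : ∀ e ∈ z.support, ∀ v ∈ (e : Sym2 V), v ∈ W := fun e he => by simpa using hzW he
  have hb : X.bdry z = 0 := by
    ext v
    by_cases hv : v ∈ W
    · exact hz (Sum.inl ⟨v, hv⟩)
    · exact X.bdry_apply_eq_zero fun e he hve => hv (hzE e he v hve)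
  obtain ⟨w₀, hw₀⟩ := hW
  have hout : ∀ v, v ∉ W → X.wind ι (X.pos v) z = 0 := by
    intro v
    obtain ⟨p⟩ := hG.preconnected v w₀
    induction p with
    | nil => exact fun h => absurd hw₀ h
    | @cons u v' w h p ih =>
      intro hu
      by_cases hv' : v' ∈ W
      · exact hz (Sum.inr (Sum.inr ⟨⟨v', u⟩, mem_edgeBoundary.2 ⟨hv', h.symm, hu⟩⟩))
      · rw [wind_pos_eq_of_adj ι hb hzE hu hv' h]
        exact ih hw₀ hv'
  refine hX.eq_zero_of_wind_eq_zero ι hb fun f => ?_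
  by_cases hf : f ∈ FW
  · exact hz (Sum.inr (Sum.inl ⟨f, hf⟩))
  · obtain ⟨v, hvf, hvW⟩ : ∃ v, X.pos v ∈ (f : Set S) ∧ v ∉ W := by
      simpa [hFW] using hf
    rw [X.wind_facePoint_eq_of_mem_face ι hb hvf (pos_notMem_carrier hzE hvW), hout v hvW]

theorem card_edgeBoundary (W : Finset V) : open Classical in (edgeBoundary G W).card =
    ∑ v ∈ W, ((G.neighborFinset v).filter (· ∉ W)).card := by
  simp [edgeBoundary]

theorem sum_degree_le (X : SurfaceEmbedding G S) (W : Finset V) :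
    ∑ v ∈ W, G.degree v ≤
      2 * (X.finite_edges_of_subset W).toFinset.card + (edgeBoundary G W).card := by
  classical
  have h1 : ∀ v, G.degree v = ((G.neighborFinset v).filter (· ∈ W)).card +
      ((G.neighborFinset v).filter (· ∉ W)).card := fun v =>
    (Finset.card_filter_add_card_filter_not _).symm
  simp only [h1, Finset.sum_add_distrib]
  rw [card_edgeBoundary]
  refine Nat.add_le_add_right ?_ _
  rw [← Finset.card_sigma, mul_comm, ← mul_one (Finset.card _)]
  refine Finset.card_mul_le_card_mul (fun (p : Σ _ : V, V) (e : G.edgeSet) => s(p.1, p.2) = e.1)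
    (fun p hp => ?_) fun e _ => ?_
  · simp only [Finset.mem_sigma, Finset.mem_filter, SimpleGraph.mem_neighborFinset] at hp
    refine Finset.card_pos.2 ⟨⟨s(p.1, p.2), hp.2.1⟩, ?_⟩
    rw [Finset.mem_bipartiteAbove]
    refine ⟨?_, rfl⟩
    simp only [Finite.mem_toFinset, mem_ofPred_eq, Sym2.mem_iff]
    rintro v (rfl | rfl)
    exacts [hp.1, hp.2.2]
  · refine (Finset.card_le_card (t := {⟨X.src e, X.tgt e⟩, ⟨X.tgt e, X.src e⟩})
      fun p hp => ?_).trans Finset.card_le_two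
    have h := (Finset.mem_bipartiteBelow _).1 hp
    rw [X.edge_eq e, Sym2.eq_iff] at h
    obtain ⟨a, b⟩ := p
    rcases h.2 with ⟨rfl, rfl⟩ | ⟨rfl, rfl⟩ <;> simp

theorem IsTessellation.curvature_eq (hX : X.IsTessellation) (ι : S ≃ₜ ℂ) (hG : G.Connected)
    (v : V) : X.curvature v =
      1 - (G.degree v : ℝ) / 2 + ∑ f ∈ hX.facesAt ι hG v, 1 / (X.faceDegree f : ℝ) := by
  have h : {f ∈ X.faces | X.pos v ∈ f} =
      Subtype.val '' (hX.facesAt ι hG v : Set X.faces) := by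
    ext f
    simp [hX.mem_facesAt, and_comm]
  rw [curvature, h, finsum_mem_image Subtype.val_injective.injOn, finsum_mem_coe_finset]

/-- There are at most `d_v` faces at the vertex `v`, since each of them contains at least two edges
at `v`, and each edge is included in two faces. -/
theorem IsTessellation.card_facesAt_le (hX : X.IsTessellation) (ι : S ≃ₜ ℂ) (hG : G.Connected)
    (v : V) : (hX.facesAt ι hG v).card ≤ G.degree v := by
  classical
  let t : Finset G.edgeSet := (G.neighborFinset v).attach.image fun w =>
    ⟨s(v, w.1), G.mem_edgeSet.2 ((G.mem_neighborFinset v w.1).1 w.2)⟩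
  have ht : t.card ≤ G.degree v := Finset.card_image_le.trans (Finset.card_attach).le
  have hmem : ∀ e : G.edgeSet, v ∈ (e : Sym2 V) → e ∈ t := by
    intro e he
    obtain ⟨w, hw⟩ := he
    have hadj : G.Adj v w := by rw [← SimpleGraph.mem_edgeSet, ← hw]; exact e.2
    exact Finset.mem_image.2 ⟨⟨w, (G.mem_neighborFinset v w).2 hadj⟩, Finset.mem_attach _ _,
      Subtype.ext hw.symm⟩
  suffices h : (hX.facesAt ι hG v).card * 2 ≤ t.card * 2 by omega
  refine Finset.card_mul_le_card_mul (fun (f : X.faces) e => e ∈ X.faceEdges f ∧ v ∈ (e : Sym2 V))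
    (fun f hf => ?_) fun e _ => ?_
  · obtain ⟨e, he, hve⟩ := hX.exists_faceEdge_of_vertex ι hG ((hX.mem_facesAt ι hG).1 hf)
    obtain ⟨e', he', hne, hve'⟩ := hX.exists_ne_faceEdge ι he hve
    rw [← Finset.card_pair hne]
    refine Finset.card_le_card fun a ha => ?_
    rw [Finset.mem_bipartiteAbove]
    rw [Finset.mem_insert, Finset.mem_singleton] at ha
    rcases ha with rfl | rfl
    · exact ⟨hmem _ hve', he', hve'⟩
    · exact ⟨hmem _ hve, he, hve⟩
  · have h2 := hX.two_faces e
    have hfin : {f ∈ X.faces | X.arc e ⊆ f}.Finite :=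
      finite_of_ncard_ne_zero (by rw [h2]; norm_num)
    rw [← h2, ← Finset.card_image_of_injective _ (Subtype.val_injective (p := (· ∈ X.faces))),
      ← ncard_coe_finset]
    refine ncard_le_ncard (fun f hf => ?_) hfin
    obtain ⟨f', hf', rfl⟩ := Finset.mem_image.1 (Finset.mem_coe.1 hf)
    exact ⟨f'.2, ((Finset.mem_bipartiteBelow _).1 hf').2.1⟩

theorem IsTessellation.curvature_le (hX : X.IsTessellation) (ι : S ≃ₜ ℂ) (hG : G.Connected)
    (v : V) : X.curvature v ≤ 1 - (G.degree v : ℝ) / 6 := by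
  have h1 : ∑ f ∈ hX.facesAt ι hG v, 1 / (X.faceDegree f : ℝ) ≤
      (hX.facesAt ι hG v).card • (1 / 3 : ℝ) := by
    refine Finset.sum_le_card_nsmul _ _ _ fun f _ => ?_
    have h3 : (3 : ℝ) ≤ X.faceDegree f := by exact_mod_cast hX.three_le_faceDegree ι f
    exact one_div_le_one_div_of_le (by norm_num) h3
  have h2 : ((hX.facesAt ι hG v).card : ℝ) ≤ G.degree v := by
    exact_mod_cast hX.card_facesAt_le ι hG v
  rw [hX.curvature_eq ι hG, nsmul_eq_mul] at *
  linarith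

/-- The combinatorial Gauss-Bonnet inequality: the total curvature of a finite set of vertices is
bounded from below in terms of the boundary. -/
theorem IsTessellation.le_sum_curvature (hX : X.IsTessellation) (ι : S ≃ₜ ℂ) (hG : G.Connected)
    {W : Finset V} (hW : W.Nonempty) :
    -(3 / 2) * ((edgeBoundary G W).card : ℝ) ≤ ∑ v ∈ W, X.curvature v := by
  classical
  have hE := hX.card_edges_le ι hG hW
  have hd := X.sum_degree_le W
  set FW := (hX.finite_faces_of_subset ι hG W).toFinset with hFW
  set nE := (X.finite_edges_of_subset W).toFinset.card
  have hF : (FW.card : ℝ) ≤ ∑ v ∈ W, ∑ f ∈ hX.facesAt ι hG v, 1 / (X.faceDegree f : ℝ) := by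
    calc (FW.card : ℝ) = ∑ f ∈ FW, (1 : ℝ) := by simp
      _ ≤ ∑ f ∈ FW, ∑ v ∈ W, if X.pos v ∈ (f : Set S) then 1 / (X.faceDegree f : ℝ) else 0 := by
        refine Finset.sum_le_sum fun f hf => ?_
        rw [← Finset.sum_filter, Finset.sum_const, nsmul_eq_mul, mul_one_div]
        have h3 := hX.three_le_faceDegree ι f
        rw [one_le_div (by exact_mod_cast (by omega : 0 < X.faceDegree f))]
        have hf' : ∀ v, X.pos v ∈ (f : Set S) → v ∈ W := by simpa [hFW] using hf
        exact_mod_cast hX.faceDegree_le ι fun v => by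
          rw [Finset.mem_filter]
          exact ⟨fun h => h.2, fun h => ⟨hf' v h, h⟩⟩
      _ = ∑ v ∈ W, ∑ f ∈ FW, if X.pos v ∈ (f : Set S) then 1 / (X.faceDegree f : ℝ) else 0 :=
        Finset.sum_comm
      _ ≤ _ := by
        refine Finset.sum_le_sum fun v _ => ?_
        rw [← Finset.sum_filter]
        refine Finset.sum_le_sum_of_subset_of_nonneg (fun f hf => ?_) fun f _ _ => by positivity
        exact (hX.mem_facesAt ι hG).2 (Finset.mem_filter.1 hf).2
  have hsum : ∑ v ∈ W, X.curvature v = (W.card : ℝ) - (∑ v ∈ W, (G.degree v : ℝ)) / 2 +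
      ∑ v ∈ W, ∑ f ∈ hX.facesAt ι hG v, 1 / (X.faceDegree f : ℝ) := by
    simp only [hX.curvature_eq ι hG, Finset.sum_add_distrib, Finset.sum_sub_distrib,
      Finset.sum_div, Finset.sum_const, nsmul_eq_mul, mul_one]
  have hE' : (nE : ℝ) ≤ W.card + (FW.card + (edgeBoundary G W).card) := by exact_mod_cast hE
  have hd' : ∑ v ∈ W, (G.degree v : ℝ) ≤ 2 * nE + (edgeBoundary G W).card := by exact_mod_cast hd
  rw [hsum]
  linarith

theorem edgeBoundary_nonempty [Infinite V] (hG : G.Connected) {W : Finset V} (hW : W.Nonempty) :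
    (edgeBoundary G W).Nonempty := by
  obtain ⟨w, hw⟩ := hW
  obtain ⟨v, hv⟩ := Infinite.exists_notMem_finset W
  obtain ⟨p⟩ := hG.preconnected w v
  obtain ⟨d, -, hd, hd'⟩ := p.exists_boundary_dart W hw hv
  exact ⟨⟨d.fst, d.snd⟩, mem_edgeBoundary.2 ⟨hd, d.adj, hd'⟩⟩

/-- A tessellation of negative asymptotic average curvature satisfies a strong isoperimetric
inequality. -/
theorem IsTessellation.exists_isoperimetric (hX : X.IsTessellation) (ι : S ≃ₜ ℂ)
    (hG : G.Connected) (hneg : X.asymptoticCurvature < 0) :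
    ∃ β : ℝ, 0 < β ∧ ∀ W : Finset V,
      β * ∑ v ∈ W, (G.degree v : ℝ) ≤ ((edgeBoundary G W).card : ℝ) := by
  have := hX.infinite ι
  obtain ⟨n, hn⟩ := iInf_lt_iff.1 hneg
  obtain ⟨c, hc, hc0⟩ := EReal.lt_iff_exists_real_btwn.1 hn
  have hc0' : c < 0 := by exact_mod_cast hc0
  -- the boundary is bounded from below in terms of the number of vertices
  have hα : ∃ α : ℝ, 0 < α ∧ ∀ W : Finset V, W.Nonempty →
      (W.card : ℝ) ≤ α * ((edgeBoundary G W).card : ℝ) := by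
    refine ⟨max ((n : ℝ) + 1) (3 / (2 * -c)), lt_max_of_lt_left (by positivity), fun W hW => ?_⟩
    have hB : (1 : ℝ) ≤ (edgeBoundary G W).card := by
      exact_mod_cast (edgeBoundary_nonempty hG hW).card_pos
    have hcard : (0 : ℝ) < W.card := by exact_mod_cast hW.card_pos
    by_cases hnW : n ≤ W.card
    · have h1 : (((∑ v ∈ W, X.curvature v) / (W.card : ℝ) : ℝ) : EReal) ≤ c :=
        (le_iSup₂ (f := fun (W : Finset V) (_ : n ≤ W.card) =>
          (((∑ v ∈ W, X.curvature v) / (W.card : ℝ) : ℝ) : EReal)) W hnW).trans hc.le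
      rw [EReal.coe_le_coe_iff, div_le_iff₀ hcard] at h1
      have h2 := hX.le_sum_curvature ι hG hW
      have h3 : (W.card : ℝ) ≤ 3 / (2 * -c) * (edgeBoundary G W).card := by
        rw [div_mul_eq_mul_div, le_div_iff₀ (by linarith)]
        linarith
      exact h3.trans (mul_le_mul_of_nonneg_right (le_max_right _ _) (by positivity))
    · have h1 : (W.card : ℝ) ≤ n + 1 := by
        have : W.card ≤ n + 1 := by omega
        exact_mod_cast this
      calc (W.card : ℝ) ≤ ((n : ℝ) + 1) * 1 := by linarith
        _ ≤ max ((n : ℝ) + 1) (3 / (2 * -c)) * (edgeBoundary G W).card :=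
          mul_le_mul (le_max_left _ _) hB zero_le_one (le_max_of_le_left (by positivity))
  obtain ⟨α, hα, hαW⟩ := hα
  refine ⟨1 / (6 * α + 9), by positivity, fun W => ?_⟩
  rcases W.eq_empty_or_nonempty with rfl | hW
  · simp
  have h1 := hX.le_sum_curvature ι hG hW
  have h2 : ∑ v ∈ W, X.curvature v ≤ W.card - (∑ v ∈ W, (G.degree v : ℝ)) / 6 := by
    refine (Finset.sum_le_sum fun v _ => hX.curvature_le ι hG v).trans_eq ?_
    simp only [Finset.sum_sub_distrib, Finset.sum_div, Finset.sum_const, nsmul_eq_mul, mul_one]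
  have h3 := hαW W hW
  rw [one_div_mul_eq_div, div_le_iff₀ (by positivity)]
  linarith

end SurfaceEmbedding

/-! ### The spectrum of an operator with a positive bounded inverse -/

open scoped ComplexOrder in
/-- If the operator `T` has a bounded inverse `A`, which is positive, then the spectrum of `T`
consists of the inverses of the nonzero elements of the spectrum of `A`, so that its bottom is the
inverse of the norm of `A`. -/
theorem isBottomOfSpectrum_of_inverse {H : Type*} [NormedAddCommGroup H] [InnerProductSpace ℂ H]
    [CompleteSpace H] [Nontrivial H] {T : H →ₗ.[ℂ] H} {A : H →L[ℂ] H} (hA : A.IsPositive)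
    (hTA : ∀ y, ∃ h : A y ∈ T.domain, T ⟨A y, h⟩ = y) (hAT : ∀ x : T.domain, A (T x) = x) :
    0 < ‖A‖ ∧ IsBottomOfSpectrum T (1 / ‖A‖) := by
  have hA0 : A ≠ 0 := by
    rintro rfl
    obtain ⟨y, hy⟩ := exists_ne (0 : H)
    obtain ⟨h, hTy⟩ := hTA y
    apply hy
    rw [← hTy, ← T.map_zero]
    congr 1
  have hnorm : 0 < ‖A‖ := norm_pos_iff.2 hA0
  have hnonneg : 0 ≤ A := (ContinuousLinearMap.nonneg_iff_isPositive A).2 hA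
  have hsa : IsSelfAdjoint A := hA.isSelfAdjoint
  have hspec : ∀ z ∈ spectrum ℂ A, z = (z.re : ℂ) ∧ 0 ≤ z.re ∧ z.re ≤ ‖A‖ := by
    intro z hz
    have h1 : z = (z.re : ℂ) := hsa.mem_spectrum_eq_re hz
    refine ⟨h1, ?_, (Complex.re_le_norm z).trans (spectrum.norm_le_norm_of_mem hz)⟩
    have h2 := spectrum_nonneg_of_nonneg hnonneg hz
    exact (Complex.nonneg_iff.1 h2).1
  refine ⟨hnorm, ?_, ?_⟩
  · rintro ⟨R, hR1, hR2⟩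
    set l : ℂ := ((1 / ‖A‖ : ℝ) : ℂ) with hl
    have hl0 : l ≠ 0 := by rw [hl]; exact_mod_cast (one_div_pos.2 hnorm).ne'
    obtain ⟨k, hk, hkr⟩ := spectrum.exists_nnnorm_eq_spectralRadius A
    rw [hsa.spectralRadius_eq_nnnorm, ENNReal.coe_inj] at hkr
    have hkn : ‖k‖ = ‖A‖ := congrArg NNReal.toReal hkr
    obtain ⟨h1, h2, -⟩ := hspec k hk
    have hkA : k = (‖A‖ : ℂ) := by
      rw [h1] at hkn ⊢
      rw [Complex.norm_real, Real.norm_of_nonneg h2] at hkn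
      rw [hkn]
    have hkl : k = l⁻¹ := by rw [hkA, hl]; simp
    -- the inverse of `1 - l A` is `1 + l R`
    have hunit : IsUnit (1 - l • A) := by
      refine ⟨⟨1 - l • A, 1 + l • R, ?_, ?_⟩, rfl⟩
      · ext y
        obtain ⟨hd, hTR⟩ := hR2 y
        have h3 : A (T ⟨R y, hd⟩) = R y := hAT ⟨R y, hd⟩
        rw [sub_eq_iff_eq_add.1 hTR, map_add, map_smul] at h3
        change (y + l • R y) - l • A (y + l • R y) = y
        rw [map_add, map_smul, h3, add_sub_cancel_right]
      · ext y
        obtain ⟨hd, hTy⟩ := hTA y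
        have h3 := hR1 ⟨A y, hd⟩
        rw [hTy] at h3
        change (y - l • A y) + l • R (y - l • A y) = y
        rw [h3, sub_add_cancel]
    have hnot : IsUnit (algebraMap ℂ (H →L[ℂ] H) k - A) := by
      have h4 : algebraMap ℂ (H →L[ℂ] H) k - A = (Units.mk0 k (hkl ▸ inv_ne_zero hl0)) •
          (1 - l • A) := by
        rw [Units.smul_def, Units.val_mk0, smul_sub, smul_smul, hkl, inv_mul_cancel₀ hl0, one_smul,
          Algebra.algebraMap_eq_smul_one]
      rw [h4]
      exact hunit.smul _
    exact spectrum.mem_iff.1 hk hnot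
  · intro z hz
    by_cases hz0 : z = 0
    · exfalso
      refine hz ⟨A, fun x => ?_, fun y => ?_⟩
      · rw [hz0, zero_smul, sub_zero, hAT]
      · obtain ⟨h, hTy⟩ := hTA y
        exact ⟨h, by rw [hz0, zero_smul, sub_zero, hTy]⟩
    have hmem : z⁻¹ ∈ spectrum ℂ A := by
      intro hunit
      apply hz
      have hunit' : IsUnit (1 - z • A) := by
        have h4 : 1 - z • A = (Units.mk0 z hz0) • (algebraMap ℂ (H →L[ℂ] H) z⁻¹ - A) := by
          rw [Units.smul_def, Units.val_mk0, smul_sub, Algebra.algebraMap_eq_smul_one, smul_smul,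
            mul_inv_cancel₀ hz0, one_smul]
        rw [h4]
        exact hunit.smul _
      obtain ⟨⟨_, B, hB1, hB2⟩, rfl⟩ := hunit'
      -- the inverse of `T - z` is `A (1 - z A)⁻¹`
      refine ⟨A * B, fun x => ?_, fun y => ?_⟩
      · have h5 : T x - z • (x : H) = (1 - z • A) (T x) := by
          change _ = T x - z • A (T x)
          rw [hAT]
        rw [h5]
        change A ((B * (1 - z • A)) (T x)) = x
        rw [hB2]
        exact hAT x
      · obtain ⟨h, hTy⟩ := hTA (B y)
        refine ⟨h, ?_⟩
        change T ⟨A (B y), h⟩ - z • A (B y) = y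
        rw [hTy]
        exact congrArg (fun F : H →L[ℂ] H => F y) hB1
    obtain ⟨h1, h2, h3⟩ := hspec _ hmem
    have h4 : 0 < (z⁻¹).re := by
      refine lt_of_le_of_ne h2 fun h => inv_ne_zero hz0 ?_
      rw [h1, ← h, Complex.ofReal_zero]
    refine ⟨((z⁻¹).re)⁻¹, ?_, ?_⟩
    · rw [Complex.ofReal_inv, ← h1, inv_inv]
    · rw [one_div]
      exact inv_anti₀ h4 h3

variable {V : Type*} {G : SimpleGraph V} [G.LocallyFinite]

/-! ### Cheeger's inequality -/

/-- The coarea inequality: the isoperimetric inequality passes from indicator functions to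
nonnegative functions of finite support, by peeling off the layers of their level sets. -/
theorem coarea_le {β : ℝ}
    (hβ : ∀ W : Finset V, β * ∑ v ∈ W, (G.degree v : ℝ) ≤ ((edgeBoundary G W).card : ℝ))
    (A : Finset V) (k : ℕ) : ∀ u : V → ℝ, (∀ v, 0 ≤ u v) → (∀ v, v ∉ A → u v = 0) →
      (A.filter fun v => u v ≠ 0).card ≤ k →
      β * ∑ v ∈ A, (G.degree v : ℝ) * u v ≤
        ∑ v ∈ A, ∑ w ∈ G.neighborFinset v, max (u v - u w) 0 := by
  classical
  induction k with
  | zero =>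
    intro u hu0 huA hk
    have h0 : ∀ v, u v = 0 := by
      intro v
      by_cases hv : v ∈ A
      · by_contra hne
        have := Finset.card_eq_zero.1 (Nat.le_zero.1 hk)
        exact Finset.notMem_empty v (this ▸ Finset.mem_filter.2 ⟨hv, hne⟩)
      · exact huA v hv
    simp [h0]
  | succ k ih =>
    intro u hu0 huA hk
    set W := A.filter fun v => u v ≠ 0 with hW
    have hWmem : ∀ v, v ∈ W ↔ u v ≠ 0 := fun v => by
      rw [hW, Finset.mem_filter]
      exact ⟨fun h => h.2, fun h => ⟨by_contra fun h' => h (huA v h'), h⟩⟩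
    rcases W.eq_empty_or_nonempty with hWe | hWn
    · have h0 : ∀ v, u v = 0 := fun v => by
        by_contra h
        exact Finset.notMem_empty v (hWe ▸ (hWmem v).2 h)
      simp [h0]
    obtain ⟨v₀, hv₀, hmin⟩ := W.exists_min_image u hWn
    set m := u v₀ with hm
    have hm0 : 0 ≤ m := hu0 v₀
    -- subtract the smallest nonzero value from `u` on the support of `u`
    let u' : V → ℝ := fun v => if v ∈ W then u v - m else 0
    have hu'W : ∀ v ∈ W, u' v = u v - m := fun v hv => if_pos hv
    have hu'0 : ∀ v, v ∉ W → u' v = 0 := fun v hv => if_neg hv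
    have hu0' : ∀ v, v ∉ W → u v = 0 := fun v hv => by
      by_contra h
      exact hv ((hWmem v).2 h)
    have hu'nn : ∀ v, 0 ≤ u' v := fun v => by
      by_cases hv : v ∈ W
      · rw [hu'W v hv]; exact sub_nonneg.2 (hmin v hv)
      · rw [hu'0 v hv]
    have hWA : W ⊆ A := Finset.filter_subset _ _
    have ih' := ih u' hu'nn (fun v hv => hu'0 v fun h => hv (hWA h)) (by
      have hss : (A.filter fun v => u' v ≠ 0) ⊂ W := by
        refine Finset.ssubset_iff_of_subset (fun v hv => ?_) |>.2 ⟨v₀, hv₀, fun h => ?_⟩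
        · by_contra h
          exact (Finset.mem_filter.1 hv).2 (hu'0 v h)
        · exact (Finset.mem_filter.1 h).2 (by rw [hu'W v₀ hv₀, sub_self])
      have := Finset.card_lt_card hss
      omega)
    have hL : ∑ v ∈ A, (G.degree v : ℝ) * u v =
        ∑ v ∈ A, (G.degree v : ℝ) * u' v + m * ∑ v ∈ W, (G.degree v : ℝ) := by
      have h1 : ∑ v ∈ W, (G.degree v : ℝ) = ∑ v ∈ A, if v ∈ W then (G.degree v : ℝ) else 0 := by
        rw [← Finset.sum_filter, Finset.filter_mem_eq_inter, Finset.inter_eq_right.2 hWA]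
      rw [h1, Finset.mul_sum, ← Finset.sum_add_distrib]
      refine Finset.sum_congr rfl fun v _ => ?_
      by_cases hv : v ∈ W
      · rw [hu'W v hv, if_pos hv]; ring
      · rw [hu'0 v hv, if_neg hv, hu0' v hv]; ring
    have hR : ∑ v ∈ A, ∑ w ∈ G.neighborFinset v, max (u v - u w) 0 =
        ∑ v ∈ A, ∑ w ∈ G.neighborFinset v, max (u' v - u' w) 0 +
          m * ((edgeBoundary G W).card : ℝ) := by
      have h1 : ((edgeBoundary G W).card : ℝ) = ∑ v ∈ A, ∑ w ∈ G.neighborFinset v,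
          if v ∈ W ∧ w ∉ W then (1 : ℝ) else 0 := by
        rw [SurfaceEmbedding.card_edgeBoundary, Nat.cast_sum]
        have h2 : ∀ v ∈ A, (∑ w ∈ G.neighborFinset v, if v ∈ W ∧ w ∉ W then (1 : ℝ) else 0) =
            if v ∈ W then (((G.neighborFinset v).filter (· ∉ W)).card : ℝ) else 0 := by
          intro v _
          by_cases hv : v ∈ W
          · simp only [hv, true_and, if_true]
            rw [Finset.sum_boole]
          · simp [hv]
        rw [Finset.sum_congr rfl h2, ← Finset.sum_filter, Finset.filter_mem_eq_inter,
          Finset.inter_eq_right.2 hWA]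
      rw [h1, Finset.mul_sum, ← Finset.sum_add_distrib]
      refine Finset.sum_congr rfl fun v _ => ?_
      rw [Finset.mul_sum, ← Finset.sum_add_distrib]
      refine Finset.sum_congr rfl fun w _ => ?_
      by_cases hv : v ∈ W
      · have h3 := hu'nn v
        by_cases hw : w ∈ W
        · rw [if_neg (by simp [hw]), hu'W v hv, hu'W w hw]
          simp
        · rw [if_pos ⟨hv, hw⟩, hu'W v hv, hu'0 w hw, hu0' w hw]
          rw [hu'W v hv] at h3
          rw [sub_zero, sub_zero, max_eq_left h3, max_eq_left (hu0 v)]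
          ring
      · rw [if_neg (by simp [hv]), hu'0 v hv, hu0' v hv, mul_zero, add_zero, zero_sub, zero_sub,
          max_eq_right (neg_nonpos.2 (hu0 w)), max_eq_right (neg_nonpos.2 (hu'nn w))]
    rw [hL, hR, mul_add]
    have := mul_le_mul_of_nonneg_left (hβ W) hm0
    linarith

/-- Cheeger's inequality: an isoperimetric inequality bounds the energy of functions of finite
support from below. -/
theorem cheeger_le {β : ℝ} (hβ0 : 0 < β)
    (hβ : ∀ W : Finset V, β * ∑ v ∈ W, (G.degree v : ℝ) ≤ ((edgeBoundary G W).card : ℝ))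
    {A : Finset V} {φ : V → ℂ} (hφ : ∀ v, v ∉ A → φ v = 0) :
    β ^ 2 / 4 * ∑ v ∈ A, (G.degree v : ℝ) * ‖φ v‖ ^ 2 ≤
      ∑ v ∈ A, ∑ w ∈ G.neighborFinset v, ‖φ v - φ w‖ ^ 2 := by
  have h1 := coarea_le hβ A _ (fun v => ‖φ v‖ ^ 2) (fun v => by positivity)
    (fun v hv => by simp [hφ v hv]) le_rfl
  -- the weights are such that the last term is absorbed by the left-hand side of `h1`
  have h2 : ∀ v w, max (‖φ v‖ ^ 2 - ‖φ w‖ ^ 2) 0 ≤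
      2 / β * ‖φ v - φ w‖ ^ 2 + β / 2 * ‖φ v‖ ^ 2 := by
    intro v w
    refine max_le ?_ (by positivity)
    have h3 : ‖φ v‖ - ‖φ w‖ ≤ ‖φ v - φ w‖ := norm_sub_norm_le _ _
    set a := ‖φ v‖
    set b := ‖φ w‖
    set c := ‖φ v - φ w‖
    have ha : 0 ≤ a := norm_nonneg _
    have hb : 0 ≤ b := norm_nonneg _
    have hc : 0 ≤ c := norm_nonneg _
    have h4 : a ^ 2 - b ^ 2 ≤ 2 * (a * c) := by
      rcases le_total a b with hab | hab
      · nlinarith [mul_nonneg ha hc]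
      · nlinarith [mul_nonneg ha (sub_nonneg.2 hab), mul_le_mul_of_nonneg_left h3 ha]
    have h5 : 2 / β * c ^ 2 + β / 2 * a ^ 2 - 2 * (a * c) = (2 * c - β * a) ^ 2 / (2 * β) := by
      field_simp
      ring
    have h6 : 0 ≤ (2 * c - β * a) ^ 2 / (2 * β) := by positivity
    linarith
  have h3 : ∑ v ∈ A, ∑ w ∈ G.neighborFinset v, max (‖φ v‖ ^ 2 - ‖φ w‖ ^ 2) 0 ≤
      2 / β * ∑ v ∈ A, ∑ w ∈ G.neighborFinset v, ‖φ v - φ w‖ ^ 2 +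
        β / 2 * ∑ v ∈ A, (G.degree v : ℝ) * ‖φ v‖ ^ 2 := by
    rw [Finset.mul_sum, Finset.mul_sum, ← Finset.sum_add_distrib]
    refine Finset.sum_le_sum fun v _ => ?_
    refine (Finset.sum_le_sum fun w _ => h2 v w).trans_eq ?_
    rw [Finset.sum_add_distrib, Finset.mul_sum, Finset.sum_const, nsmul_eq_mul,
      SimpleGraph.card_neighborFinset_eq_degree]
    ring
  have h4 := h1.trans h3
  set D := ∑ v ∈ A, (G.degree v : ℝ) * ‖φ v‖ ^ 2
  set Q := ∑ v ∈ A, ∑ w ∈ G.neighborFinset v, ‖φ v - φ w‖ ^ 2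
  have h5 : β / 2 * D ≤ 2 / β * Q := by linarith
  calc β ^ 2 / 4 * D = β / 2 * (β / 2 * D) := by ring
    _ ≤ β / 2 * (2 / β * Q) := mul_le_mul_of_nonneg_left h5 (by positivity)
    _ = Q := by field_simp

/-- Green's formula for functions of finite support, as an inequality. -/
theorem energy_le {A : Finset V} {φ : V → ℂ} (hφ : ∀ v, v ∉ A → φ v = 0) :
    ∑ v ∈ A, ∑ w ∈ G.neighborFinset v, ‖φ v - φ w‖ ^ 2 ≤
      2 * (∑ v ∈ A, star (φ v) * formalLaplacian G φ v).re := by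
  classical
  -- the set `B` contains `A` and all neighbours of elements of `A`
  set B := A ∪ A.biUnion fun v => G.neighborFinset v with hB
  have hAB : A ⊆ B := Finset.subset_union_left
  have hnb : ∀ v ∈ A, ∀ w, G.Adj v w → w ∈ B := fun v hv w hw =>
    Finset.mem_union_right _ (Finset.mem_biUnion.2 ⟨v, hv, (G.mem_neighborFinset v w).2 hw⟩)
  have hconv : ∀ {M : Type} [AddCommMonoid M] (F : V → V → M), ∀ v ∈ A,
      ∑ w ∈ G.neighborFinset v, F v w = ∑ w ∈ B, if G.Adj v w then F v w else 0 := by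
    intro M _ F v hv
    rw [← Finset.sum_filter]
    refine Finset.sum_congr (Finset.ext fun w => ?_) fun _ _ => rfl
    rw [SimpleGraph.mem_neighborFinset, Finset.mem_filter]
    exact ⟨fun h => ⟨hnb v hv w h, h⟩, fun h => h.2⟩
  have h1 : ∑ v ∈ A, star (φ v) * formalLaplacian G φ v =
      ∑ v ∈ B, ∑ w ∈ B, if G.Adj v w then star (φ v) * (φ v - φ w) else 0 := by
    rw [← Finset.sum_subset hAB fun v _ hv => ?_]
    · refine Finset.sum_congr rfl fun v hv => ?_
      rw [← hconv (fun v w => star (φ v) * (φ v - φ w)) v hv, ← Finset.mul_sum]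
      rfl
    · simp [hφ v hv]
  have h2 : ∑ v ∈ A, ∑ w ∈ G.neighborFinset v, ‖φ v - φ w‖ ^ 2 ≤
      ∑ v ∈ B, ∑ w ∈ B, if G.Adj v w then ‖φ v - φ w‖ ^ 2 else 0 := by
    rw [Finset.sum_congr rfl (hconv fun v w => ‖φ v - φ w‖ ^ 2)]
    refine Finset.sum_le_sum_of_subset_of_nonneg hAB fun v _ _ => Finset.sum_nonneg fun w _ => ?_
    split_ifs <;> positivity
  refine h2.trans_eq ?_
  have h3 : ∑ v ∈ B, ∑ w ∈ B, (if G.Adj v w then star (φ v) * (φ v - φ w) else 0) =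
      ∑ v ∈ B, ∑ w ∈ B, if G.Adj v w then star (φ w) * (φ w - φ v) else 0 := by
    rw [Finset.sum_comm]
    simp only [G.adj_comm]
  rw [h1, two_mul, ← Complex.add_re]
  nth_rewrite 2 [h3]
  simp only [← Finset.sum_add_distrib, Complex.re_sum]
  refine Finset.sum_congr rfl fun v _ => Finset.sum_congr rfl fun w _ => ?_
  split_ifs
  · rw [← Complex.normSq_eq_norm_sq, Complex.normSq_apply]
    simp
    ring
  · simp

/-! ### Square summable harmonic functions -/

/-- On a connected infinite graph, a square summable harmonic function vanishes, since its absolute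
value attains a maximum. -/
theorem eq_zero_of_formalLaplacian_eq_zero [Infinite V] (hG : G.Connected)
    (ψ : lp (fun _ : V => ℂ) 2) (h : formalLaplacian G ψ = 0) : ψ = 0 := by
  have hsum : Summable fun v => ‖ψ v‖ ^ 2 := by
    have := (lp.memℓp ψ).summable (by norm_num)
    simpa using this
  by_contra hne
  obtain ⟨v₀, hv₀⟩ : ∃ v, ψ v ≠ 0 := by
    by_contra! h0
    exact hne (lp.ext (funext h0))
  have hfin : ∀ c : ℝ, 0 < c → {v | c ≤ ‖ψ v‖}.Finite := by
    intro c hc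
    have h1 := hsum.tendsto_cofinite_zero.eventually_lt_const (show 0 < c ^ 2 by positivity)
    rw [Filter.eventually_cofinite] at h1
    refine h1.subset fun v hv => ?_
    rw [mem_ofPred_eq, not_lt]
    exact pow_le_pow_left₀ hc.le hv 2
  obtain ⟨m, hm, hmax⟩ := (hfin _ (norm_pos_iff.2 hv₀)).exists_maximalFor (fun v => ‖ψ v‖) _
    ⟨v₀, le_refl ‖ψ v₀‖⟩
  have hM0 : 0 < ‖ψ m‖ := (norm_pos_iff.2 hv₀).trans_le hm
  have hle : ∀ v, ‖ψ v‖ ≤ ‖ψ m‖ := by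
    intro v
    by_contra! hlt
    exact absurd (hmax (hm.trans hlt.le) hlt.le) (not_le.2 hlt)
  have hstep : ∀ v w, G.Adj v w → ‖ψ v‖ = ‖ψ m‖ → ‖ψ w‖ = ‖ψ m‖ := by
    intro v w hvw hv
    have h1 : ∑ u ∈ G.neighborFinset v, (ψ v - ψ u) = 0 := congrFun h v
    rw [Finset.sum_sub_distrib, sub_eq_zero] at h1
    have h2 : ∑ u ∈ G.neighborFinset v, ‖ψ m‖ ≤ ∑ u ∈ G.neighborFinset v, ‖ψ u‖ := by
      calc ∑ u ∈ G.neighborFinset v, ‖ψ m‖ = ‖∑ u ∈ G.neighborFinset v, ψ v‖ := by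
            rw [Finset.sum_const, Finset.sum_const, nsmul_eq_mul, nsmul_eq_mul, norm_mul, hv]
            simp
        _ ≤ ∑ u ∈ G.neighborFinset v, ‖ψ u‖ := by rw [h1]; exact norm_sum_le _ _
    exact (Finset.sum_eq_sum_iff_of_le fun u _ => hle u).1
      (le_antisymm (Finset.sum_le_sum fun u _ => hle u) h2) w ((G.mem_neighborFinset v w).2 hvw)
  have hall : ∀ v, ‖ψ v‖ = ‖ψ m‖ := by
    intro v
    obtain ⟨p⟩ := hG.preconnected v m
    induction p with
    | nil => rfl
    | cons hadj _ ih => exact hstep _ _ hadj.symm (ih hm hmax hM0 hle hstep)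
  refine (Set.infinite_univ (α := V)) ((hfin _ hM0).subset fun v _ => ?_)
  exact (hall v).ge

/-! ### The inverse of the Laplacian -/

/-- The functions of finite support as elements of `ℓ²(V)`. -/
def finiteIncl (V : Type*) : (V →₀ ℂ) →ₗ[ℂ] lp (fun _ : V => ℂ) 2 :=
  open Classical in Finsupp.linearCombination ℂ fun v => lp.single 2 v (1 : ℂ)

/-- The Laplacian on the functions of finite support. -/
def finiteLaplacian (G : SimpleGraph V) [G.LocallyFinite] :
    (V →₀ ℂ) →ₗ[ℂ] lp (fun _ : V => ℂ) 2 :=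
  open Classical in Finsupp.linearCombination ℂ fun v =>
    ∑ w ∈ G.neighborFinset v, (lp.single 2 v (1 : ℂ) - lp.single 2 w (1 : ℂ))

theorem coeFn_finiteIncl (φ : V →₀ ℂ) : (finiteIncl V φ : V → ℂ) = φ := by
  classical
  induction φ using Finsupp.induction_linear with
  | zero => rw [map_zero]; rfl
  | add f g hf hg => rw [map_add, lp.coeFn_add, hf, hg, Finsupp.coe_add]
  | single v c =>
    rw [finiteIncl, Finsupp.linearCombination_single, lp.coeFn_smul, lp.coeFn_single]
    ext w
    by_cases hw : w = v
    · subst hw; simp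
    · simp [hw]

theorem inner_finiteIncl (φ : V →₀ ℂ) (x : lp (fun _ : V => ℂ) 2) :
    inner ℂ (finiteIncl V φ) x = ∑ v ∈ φ.support, star (φ v) * x v := by
  classical
  rw [finiteIncl, Finsupp.linearCombination_apply, Finsupp.sum, sum_inner]
  refine Finset.sum_congr rfl fun v _ => ?_
  rw [inner_smul_left, lp.inner_single_left]
  simp

theorem inner_finiteLaplacian (φ : V →₀ ℂ) (x : lp (fun _ : V => ℂ) 2) :
    inner ℂ (finiteLaplacian G φ) x = ∑ v ∈ φ.support, star (φ v) * formalLaplacian G x v := by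
  classical
  rw [finiteLaplacian, Finsupp.linearCombination_apply, Finsupp.sum, sum_inner]
  refine Finset.sum_congr rfl fun v _ => ?_
  rw [inner_smul_left, sum_inner]
  congr 1
  refine Finset.sum_congr rfl fun w _ => ?_
  rw [inner_sub_left, lp.inner_single_left, lp.inner_single_left]
  simp

theorem inner_finiteLaplacian_single (v : V) (x : lp (fun _ : V => ℂ) 2) :
    inner ℂ (finiteLaplacian G (Finsupp.single v 1)) x = formalLaplacian G x v := by
  classical
  rw [inner_finiteLaplacian, Finsupp.support_single v one_ne_zero]
  simp

theorem inner_finiteIncl_single (v : V) (x : lp (fun _ : V => ℂ) 2) :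
    inner ℂ (finiteIncl V (Finsupp.single v 1)) x = x v := by
  rw [inner_finiteIncl, Finsupp.support_single v one_ne_zero]
  simp

theorem coeFn_finiteLaplacian (φ : V →₀ ℂ) :
    (finiteLaplacian G φ : V → ℂ) = formalLaplacian G φ := by
  classical
  induction φ using Finsupp.induction_linear with
  | zero => rw [map_zero, Finsupp.coe_zero, map_zero]; rfl
  | add f g hf hg => rw [map_add, lp.coeFn_add, hf, hg, Finsupp.coe_add, map_add]
  | single v c =>
    ext u
    rw [← inner_finiteIncl_single u, finiteLaplacian, Finsupp.linearCombination_single,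
      inner_smul_right, inner_sum]
    simp only [inner_sub_right, inner_finiteIncl_single, formalLaplacian, LinearMap.coe_mk,
      AddHom.coe_mk, lp.coeFn_single, Finset.sum_sub_distrib, Finset.sum_const, Pi.single_apply,
      Finsupp.single_apply, nsmul_eq_mul, Finset.sum_ite_eq, SimpleGraph.mem_neighborFinset,
      SimpleGraph.card_neighborFinset_eq_degree, G.adj_comm u v]
    by_cases huv : u = v
    · subst huv; simp [mul_comm]
    · simp [huv, Ne.symm huv]

theorem inner_finiteLaplacian_finiteIncl (φ ψ : V →₀ ℂ) :
    inner ℂ (finiteLaplacian G φ) (finiteIncl V ψ) =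
      inner ℂ (finiteIncl V φ) (finiteLaplacian G ψ) := by
  rw [inner_finiteLaplacian, inner_finiteIncl, coeFn_finiteIncl, coeFn_finiteLaplacian]

/-- On a graph with an isoperimetric inequality, the Laplacian is bounded from below by a positive
constant on the functions of finite support. -/
theorem exists_le_inner_finiteLaplacian [Infinite V] (hG : G.Connected) {β : ℝ} (hβ0 : 0 < β)
    (hβ : ∀ W : Finset V, β * ∑ v ∈ W, (G.degree v : ℝ) ≤ ((edgeBoundary G W).card : ℝ)) :
    ∃ c : ℝ, 0 < c ∧ ∀ φ : V →₀ ℂ,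
      c * ‖finiteIncl V φ‖ ^ 2 ≤ (inner ℂ (finiteIncl V φ) (finiteLaplacian G φ)).re := by
  refine ⟨β ^ 2 / 8, by positivity, fun φ => ?_⟩
  have hφ : ∀ v, v ∉ φ.support → φ v = 0 := fun v hv => Finsupp.notMem_support_iff.1 hv
  have h1 := cheeger_le hβ0 hβ hφ
  have h2 := energy_le (G := G) hφ
  have h3 : ‖finiteIncl V φ‖ ^ 2 = ∑ v ∈ φ.support, ‖φ v‖ ^ 2 := by
    rw [← inner_self_eq_norm_sq (𝕜 := ℂ), inner_finiteIncl, coeFn_finiteIncl, map_sum]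
    refine Finset.sum_congr rfl fun v _ => ?_
    rw [← Complex.normSq_eq_norm_sq, Complex.normSq_apply]
    simp
  have h4 : ‖finiteIncl V φ‖ ^ 2 ≤ ∑ v ∈ φ.support, (G.degree v : ℝ) * ‖φ v‖ ^ 2 := by
    rw [h3]
    refine Finset.sum_le_sum fun v _ => le_mul_of_one_le_left (by positivity) ?_
    exact_mod_cast hG.preconnected.degree_pos_of_nontrivial v
  rw [inner_finiteIncl, coeFn_finiteLaplacian]
  have h5 := mul_le_mul_of_nonneg_left h4 (show 0 ≤ β ^ 2 / 4 by positivity)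
  linarith

theorem denseRange_finiteLaplacian [Infinite V] (hG : G.Connected) :
    DenseRange (finiteLaplacian G) := by
  have h : (LinearMap.range (finiteLaplacian G))ᗮ = ⊥ := by
    rw [Submodule.eq_bot_iff]
    intro ψ hψ
    refine eq_zero_of_formalLaplacian_eq_zero hG ψ (funext fun v => ?_)
    rw [← inner_finiteLaplacian_single]
    exact (Submodule.mem_orthogonal _ _).1 hψ _ ⟨_, rfl⟩
  have h2 := Submodule.topologicalClosure_eq_top_iff.2 h
  have h3 := Submodule.dense_iff_topologicalClosure_eq_top.2 h2
  rwa [LinearMap.coe_range] at h3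

/-- A lower bound of the Laplacian on the functions of finite support by a positive constant yields
a positive bounded inverse of the Laplacian on its maximal domain. -/
theorem exists_inverse_laplacian [Infinite V] (hG : G.Connected) {c : ℝ} (hc : 0 < c)
    (h : ∀ φ : V →₀ ℂ,
      c * ‖finiteIncl V φ‖ ^ 2 ≤ (inner ℂ (finiteIncl V φ) (finiteLaplacian G φ)).re) :
    ∃ A : lp (fun _ : V => ℂ) 2 →L[ℂ] lp (fun _ : V => ℂ) 2, A.IsPositive ∧
      (∀ y, ∃ hy : A y ∈ (laplacian G).domain, laplacian G ⟨A y, hy⟩ = y) ∧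
      ∀ x : (laplacian G).domain, A (laplacian G x) = x := by
  have hd := denseRange_finiteLaplacian hG
  have hbound : ∃ C, ∀ φ, ‖finiteIncl V φ‖ ≤ C * ‖finiteLaplacian G φ‖ := by
    refine ⟨1 / c, fun φ => ?_⟩
    have h1 := (h φ).trans ((Complex.re_le_norm _).trans (norm_inner_le_norm _ _))
    rw [one_div_mul_eq_div, le_div_iff₀ hc]
    rcases (norm_nonneg (finiteIncl V φ)).eq_or_lt with h0 | h0
    · rw [← h0, zero_mul]; exact norm_nonneg _
    · refine le_of_mul_le_mul_left ?_ h0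
      linarith
  let A := (finiteIncl V).extendOfNorm (finiteLaplacian G)
  have hA : ∀ φ, A (finiteLaplacian G φ) = finiteIncl V φ :=
    LinearMap.extendOfNorm_eq hd hbound
  have hsymm : ∀ x y, inner ℂ (A x) y = inner ℂ x (A y) := by
    intro x y
    refine hd.induction_on₂ (p := fun x y => inner ℂ (A x) y = inner ℂ x (A y)) ?_ ?_ x y
    · exact isClosed_eq (by fun_prop) (by fun_prop)
    · intro φ ψ
      rw [hA, hA, inner_finiteLaplacian_finiteIncl]
  have hpos : ∀ x, 0 ≤ (inner ℂ (A x) x).re := by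
    intro x
    refine hd.induction_on (p := fun x => 0 ≤ (inner ℂ (A x) x).re) x ?_ ?_
    · exact isClosed_le continuous_const (Complex.continuous_re.comp (by fun_prop))
    · intro φ
      rw [hA]
      exact le_trans (by positivity) (h φ)
  have hTA : ∀ y, formalLaplacian G (A y) = y := by
    intro y
    ext v
    rw [← inner_finiteLaplacian_single, ← inner_finiteIncl_single v y, ← hA, hsymm]
  have hmem : ∀ y, A y ∈ (laplacian G).domain := fun y => by
    change Memℓp (formalLaplacian G (A y)) 2
    rw [hTA]
    exact lp.memℓp y
  refine ⟨A, ⟨hsymm, hpos⟩, fun y => ⟨hmem y, lp.ext (hTA y)⟩, fun x => ?_⟩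
  rw [← sub_eq_zero]
  refine eq_zero_of_formalLaplacian_eq_zero hG _ ?_
  rw [lp.coeFn_sub, map_sub, hTA]
  exact sub_self _

end PlanarTess

end

theorem mainTheorem2 {V : Type*} (G : SimpleGraph V) [G.LocallyFinite] (hG : G.Connected)
    {S : Type*} [TopologicalSpace S] (hS : Nonempty (S ≃ₜ EuclideanSpace ℝ (Fin 2)))
    (X : PlanarTess.SurfaceEmbedding G S) (hX : X.IsTessellation)
    (hneg : X.asymptoticCurvature < 0) :
    ∃ l : ℝ, PlanarTess.IsBottomOfSpectrum (PlanarTess.laplacian G) l ∧ 0 < l := by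
  classical
  obtain ⟨ψ⟩ := hS
  let ι : S ≃ₜ ℂ := ψ.trans Complex.orthonormalBasisOneI.repr.symm.toHomeomorph
  have := hX.infinite ι
  obtain ⟨β, hβ0, hβ⟩ := hX.exists_isoperimetric ι hG hneg
  obtain ⟨c, hc, hle⟩ := PlanarTess.exists_le_inner_finiteLaplacian hG hβ0 hβ
  obtain ⟨A, hA, hTA, hAT⟩ := PlanarTess.exists_inverse_laplacian hG hc hle
  have hnt : Nontrivial (lp (fun _ : V => ℂ) 2) := by
    obtain ⟨v⟩ := hG.nonempty
    refine ⟨lp.single 2 v (1 : ℂ), 0, fun h => ?_⟩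
    have h1 := congrArg (fun f : lp (fun _ : V => ℂ) 2 => f v) h
    simp at h1
  obtain ⟨hpos, hbot⟩ := PlanarTess.isBottomOfSpectrum_of_inverse hA hTA hAT
  exact ⟨_, hbot, one_div_pos.2 hpos⟩
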